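/- Fix an infinite set $\mathbb D$ of data values. A data word over a finite alphabet $A$ is a word over $A\times\mathbb D$; $\pi$ denotes the projection to the word over $A$. For a finite stack alphabet $\Gamma$, a $0$-stack is an element of $\Gamma\times(\mathbb D\cup\{\mathsf{no\text{-}data}\})$, and a $k$-stack ($k\ge 1$) is a finite sequence of $(k-1)$-stacks (top at the right); an $n$-stack is well formed if every $k$-stack in it, $1\le k\le n$, is nonempty. An $n$-HOPAD (deterministic higher-order pushdown automaton with data, of level $n$) consists of $A$, $\Gamma$, an initial symbol $\gamma_I\in\Gamma$, a finite state set $Q$, an initial state $q_I$, accepting states $F\subseteq Q$, and a partial function from $Q\times\Gamma\times(A\cup\{\varepsilon\})$ to $Q\times OP$, where $OP$ consists of the operations $\mathsf{pop}^k$ and $\mathsf{push}^k_\beta$ ($1\le k\le n$, $\beta\in\Gamma$); the function is never defined both at $(q,\alpha,\varepsilon)$ and at some $(q,\alpha,a)$ with $a\in A$. A configuration is a state with a well-formed $n$-stack; initially the state is $q_I$ and the stack contains the single $0$-stack $(\gamma_I,\mathsf{no\text{-}data})$. A transition is chosen by the state, the symbol of the topmost $0$-stack and the input letter $a$ (or $\varepsilon$),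 and reads a data value $d$ together with $a$ ($d=\mathsf{no\text{-}data}$ for $\varepsilon$). $\mathsf{pop}^k$ removes the topmost $(k-1)$-stack of the topmost $k$-stack, and is possible only if the resulting stack is well formed and either $d=\mathsf{no\text{-}data}$ or $d$ equals the data value of the topmost $0$-stack. $\mathsf{push}^k_\beta$ duplicates the topmost $(k-1)$-stack of the topmost $k$-stack and then replaces the topmost $0$-stack by $(\beta,d)$. A data word is accepted if some run from the initial configuration to a configuration with an accepting state reads it. Let $A=\{[,],\$\}$. Let $U$ be the set of data words of the form $q\,m\,\$\,s$ (the dollar carries an arbitrary data value) such that $q,m,s$ contain no dollar; $qms$ and $m$ project to well-formed bracket expressions; $q$ is empty or ends with an opening bracket (which is then the last opening bracket not closed before the dollar); and $s$ is symmetric to $q$: $|s|=|q|$, and for all $i$ the $i$-th letter of $q$ and the $i$-th letter of $s$ from the end have the same data value, and one of them is $[$ and the other $]$. Given $n$ and $Q$, let $M$ be the four-element monoid testing whether a word is empty, is a single closing bracket, begins with a dollar, or is any other word, and define for $k=n,n-1,\dots,0$ $$\mathcal T^k=\{\mathsf{ne}\}\cup\bigl(\mathcal P(\mathcal T^n)\times\dots\times\mathcal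 P(\mathcal T^{k+1})\times Q\times\mathcal D^k\bigr),\qquad \mathcal D^k=\bigcup_{r=k+1}^n M\times\{r\}\times\mathcal P(\mathcal T^n)\times\dots\times\mathcal P(\mathcal T^{r+1})\times Q .$$ Let $N=2+2^{\sum_{i=0}^n|\mathcal T^i|}$, $w_0=[\,]\,[$ and $w_{k+1}=w_k^N\,]^N\,[$. **Statement.** Let $n\ge 0$, and let $\mathcal A$ be an $n$-HOPAD with state set $Q$. Suppose that $\mathcal A$ recognizes $U$, and let $\overline w_n$ be a data word with $\pi(\overline w_n)=w_n$ in which all data values are distinct. Then there is a unique run $R$ of $\mathcal A$ from the initial configuration which reads $\overline w_n$ and ends just after reading its last letter. For a prefix $v$ of $w_n$ let $R(v)$ be the configuration of $R$ just after reading $|v|$ letters. Then 1. for every $0\le k\le n$ and every word $u$ such that $uw_k$ is a prefix of $w_n$, some data value read by the part of $R$ between $R(u)$ and $R(uw_k)$ does not appear in the topmost $k$-stack of $R(uw_k)$; 2. for every prefix $v$ of $w_n$, every data value read by $R$ up to $R(v)$ appears in the stack of $R(v)$. For $k=n$ and $u=\varepsilon$, (1) contradicts (2) with $v=w_n$; consequently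 no $n$-HOPAD recognizes $U$. -/

import Mathlib

/-! ## Stacks of higher order

The topmost element of a stack is the *head* of the list. -/

/-- `k`-stacks over the stack alphabet `Γ` with data values from `D`: a `0`-stack is a symbol with
possibly a data value (`none` stands for "no data"), a `(k+1)`-stack is a sequence of `k`-stacks. -/
def HStack (Γ : Type*) (D : Type*) : ℕ → Type _
  | 0 => Γ × Option D
  | k + 1 => List (HStack Γ D k)

namespace HStack

variable {Γ : Type*} {D : Type*}

/-- The sequence of `k`-stacks that a `(k+1)`-stack consists of. -/
def items {k : ℕ} (s : HStack Γ D (k + 1)) : List (HStack Γ D k) := s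

/-- Every `k`-stack with `k ≥ 1` occurring in the stack (itself included) is nonempty. -/
def WellFormed : (k : ℕ) → HStack Γ D k → Prop
  | 0, _ => True
  | k + 1, s => items s ≠ [] ∧ ∀ t : HStack Γ D k, t ∈ items s → WellFormed k t

/-- The data values that appear in a stack. -/
def dataValues : (k : ℕ) → HStack Γ D k → Set D
  | 0, s => {d | (s : Γ × Option D).2 = some d}
  | k + 1, s => {d | ∃ t : HStack Γ D k, t ∈ items s ∧ d ∈ dataValues k t}

/-- `IsTop k t n s`: the `k`-stack `t` is the topmost `k`-stack of the `n`-stack `s`. -/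
inductive IsTop (k : ℕ) (t : HStack Γ D k) : (n : ℕ) → HStack Γ D n → Prop
  | refl : IsTop k t k t
  | cons {n : ℕ} {s : HStack Γ D n} (r : List (HStack Γ D n)) (h : IsTop k t n s) :
      IsTop k t (n + 1) (s :: r : List (HStack Γ D n))

/-- The topmost `0`-stack, if there is one. -/
def top0 : (n : ℕ) → HStack Γ D n → Option (Γ × Option D)
  | 0, s => some s
  | n + 1, s => match items s with
    | [] => none
    | t :: _ => top0 n t

/-- Replace the topmost `0`-stack by `x`. -/
def setTop (x : Γ × Option D) : (n : ℕ) → HStack Γ D n → HStack Γ D n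
  | 0, _ => x
  | n + 1, s => match items s with
    | [] => ([] : List (HStack Γ D n))
    | t :: r => (setTop x n t :: r : List (HStack Γ D n))

/-- `pop^k`: remove the topmost `(k-1)`-stack from the topmost `k`-stack. -/
def pop (k : ℕ) : (n : ℕ) → HStack Γ D n → Option (HStack Γ D n)
  | 0, _ => none
  | n + 1, s => match items s with
    | [] => none
    | t :: r =>
      if k = n + 1 then some r
      else (pop k n t).map fun t' => (t' :: r : List (HStack Γ D n))

/-- `push^k`: duplicate the topmost `(k-1)`-stack in the topmost `k`-stack, and then replace
the topmost `0`-stack by `x`. -/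
def push (k : ℕ) (x : Γ × Option D) : (n : ℕ) → HStack Γ D n → Option (HStack Γ D n)
  | 0, _ => none
  | n + 1, s => match items s with
    | [] => none
    | t :: r =>
      if k = n + 1 then some (setTop x n t :: t :: r : List (HStack Γ D n))
      else (push k x n t).map fun t' => (t' :: r : List (HStack Γ D n))

/-- The `n`-stack containing only one `0`-stack `x`. -/
def single (x : Γ × Option D) : (n : ℕ) → HStack Γ D n
  | 0 => x
  | n + 1 => ([single x n] : List (HStack Γ D n))

theorem wellFormed_single (x : Γ × Option D) : ∀ n : ℕ, WellFormed n (single x n)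
  | 0 => trivial
  | n + 1 => by
    refine ⟨List.cons_ne_nil _ _, fun t ht => ?_⟩
    obtain rfl : t = single x n := List.mem_singleton.mp ht
    exact wellFormed_single x n

end HStack

/-! ## Deterministic higher-order pushdown automata with data -/

/-- Stack operations of level at most `n`; the index `k : Fin n` stands for the level `k + 1`. -/
inductive StackOp (n : ℕ) (Γ : Type*)
  | pop (k : Fin n) : StackOp n Γ
  | push (k : Fin n) (β : Γ) : StackOp n Γ

/-- A deterministic higher-order pushdown automaton with data, of level `n`, with input alphabet
`A`, stack alphabet `Γ` and state set `Q`.  An input letter `none` is an `ε`-transition. -/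
structure HOPAD (n : ℕ) (A Γ Q : Type*) where
  initSymbol : Γ
  initState : Q
  accepting : Set Q
  trans : Q → Γ → Option A → Option (Q × StackOp n Γ)
  deterministic : ∀ (q : Q) (α : Γ) (a : A),
    trans q α (some a) ≠ none → trans q α none = none

namespace HOPAD

variable {n : ℕ} {A Γ Q : Type*}

/-- Configurations: a state and a well-formed `n`-stack. -/
@[ext] structure Config (n : ℕ) (Γ Q D : Type*) where
  state : Q
  stack : HStack Γ D n
  wf : HStack.WellFormed n stack

/-- The initial configuration. -/
def init (M : HOPAD n A Γ Q) (D : Type*) : Config n Γ Q D where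
  state := M.initState
  stack := HStack.single (M.initSymbol, none) n
  wf := HStack.wellFormed_single _ n

/-- The effect of an operation on a stack whose topmost `0`-stack carries the data value `d'`,
when the data value `d` is read (`none` stands for "no data"). -/
def Performs {D : Type*} (d' d : Option D) (s s' : HStack Γ D n) : StackOp n Γ → Prop
  | StackOp.pop k => HStack.pop (k + 1) n s = some s' ∧ (d = none ∨ d = d')
  | StackOp.push k β => HStack.push (k + 1) (β, d) n s = some s'

/-- One step `c ⊢ˣ c'`; the label `x` is `none` for an `ε`-transition, and `some (a, d)` if the
letter `a` with the data value `d` is read. -/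
def Step (M : HOPAD n A Γ Q) {D : Type*} (c : Config n Γ Q D) (x : Option (A × D))
    (c' : Config n Γ Q D) : Prop :=
  ∃ (α : Γ) (d' : Option D) (op : StackOp n Γ),
    HStack.top0 n c.stack = some (α, d') ∧
    M.trans c.state α (x.map Prod.fst) = some (c'.state, op) ∧
    Performs d' (x.map Prod.snd) c.stack c'.stack op

/-- A run from a given first configuration is recorded as the list of its steps, each with its
label and the configuration reached. -/
abbrev Steps (n : ℕ) (A Γ Q D : Type*) : Type _ := List (Option (A × D) × Config n Γ Q D)

/-- `R` is a run of `M` from the configuration `c`. -/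
def IsRun (M : HOPAD n A Γ Q) {D : Type*} : Config n Γ Q D → Steps n A Γ Q D → Prop
  | _, [] => True
  | c, (x, c') :: R => M.Step c x c' ∧ IsRun M c' R

namespace Steps

variable {D : Type*}

/-- The data word read by a run. -/
def word (R : Steps n A Γ Q D) : List (A × D) := R.filterMap Prod.fst

/-- The last configuration of a run from `c`. -/
def last : Config n Γ Q D → Steps n A Γ Q D → Config n Γ Q D
  | c, [] => c
  | _, (_, c') :: R => last c' R

/-- The initial part of a run that ends just after reading `j` letters (the empty run for `j = 0`;
the whole run if it reads fewer than `j` letters). -/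
def upTo : ℕ → Steps n A Γ Q D → Steps n A Γ Q D
  | 0, _ => []
  | _ + 1, [] => []
  | j + 1, (none, c) :: R => (none, c) :: upTo (j + 1) R
  | j + 1, (some x, c) :: R => (some x, c) :: upTo j R

/-- The part of a run between the moments just after reading `i` and just after reading `j`
letters. -/
def segment (i j : ℕ) (R : Steps n A Γ Q D) : Steps n A Γ Q D :=
  (upTo j R).drop (upTo i R).length

end Steps

/-- The data value `d` is read by a run (or by a part of a run). -/
def ReadsValue {D : Type*} (R : Steps n A Γ Q D) (d : D) : Prop :=
  ∃ a : A, (a, d) ∈ Steps.word R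

/-- `R` is a run of `M` from the initial configuration which reads `w` and ends just after
reading the last letter of `w`. -/
def IsExactRun (M : HOPAD n A Γ Q) {D : Type*} (w : List (A × D)) (R : Steps n A Γ Q D) : Prop :=
  M.IsRun (M.init D) R ∧ Steps.word R = w ∧ Steps.upTo w.length R = R

/-- The data word `w` is accepted by `M`. -/
def Accepts (M : HOPAD n A Γ Q) {D : Type*} (w : List (A × D)) : Prop :=
  ∃ R : Steps n A Γ Q D, M.IsRun (M.init D) R ∧ Steps.word R = w ∧
    (Steps.last (M.init D) R).state ∈ M.accepting

/-- `M` recognizes the data language `L`. -/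
def Recognizes (M : HOPAD n A Γ Q) {D : Type*} (L : Set (List (A × D))) : Prop :=
  ∀ w : List (A × D), M.Accepts w ↔ w ∈ L

end HOPAD

/-! ## The separating language -/

/-- The input alphabet: opening bracket, closing bracket, dollar. -/
inductive Letter
  | opening : Letter
  | closing : Letter
  | dollar : Letter

/-- The projection of a data word to its letters. -/
def letters {A D : Type*} (w : List (A × D)) : List A := w.map Prod.fst

/-- The number of opening brackets minus the number of closing brackets. -/
def bracketHeight : List Letter → ℤ
  | [] => 0
  | Letter.opening :: w => bracketHeight w + 1
  | Letter.closing :: w => bracketHeight w - 1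
  | Letter.dollar :: w => bracketHeight w

/-- Well-formed bracket expressions. -/
def IsBracketExpr (w : List Letter) : Prop :=
  Letter.dollar ∉ w ∧ (∀ v : List Letter, v <+: w → 0 ≤ bracketHeight v) ∧ bracketHeight w = 0

/-- Opposite brackets carrying the same data value. -/
def OppositeBrackets {D : Type*} (x y : Letter × D) : Prop :=
  x.2 = y.2 ∧ ((x.1 = Letter.opening ∧ y.1 = Letter.closing) ∨
    (x.1 = Letter.closing ∧ y.1 = Letter.opening))

/-- The language `U`: words `q m $ s` (with arbitrary data values) such that `q m s` is a
well-formed bracket expression, `m` is a well-formed bracket expression, `q` is empty or ends with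
an opening bracket (the last one not closed before the dollar), and `s` is symmetric to `q`, that
is, the `i`-th letter of `q` and the `i`-th letter of `s` from the end are opposite. -/
def langU (D : Type*) : Set (List (Letter × D)) :=
  {w | ∃ (q m s : List (Letter × D)) (d : D),
    w = q ++ m ++ (Letter.dollar, d) :: s ∧
    IsBracketExpr (letters (q ++ m ++ s)) ∧
    IsBracketExpr (letters m) ∧
    (q = [] ∨ ∃ (q' : List (Letter × D)) (e : D), q = q' ++ [(Letter.opening, e)]) ∧
    List.Forall₂ OppositeBrackets q s.reverse}

universe u

/-! ## The words `w_k` and the number `N` -/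

/-- The four-element monoid distinguishing whether a word is empty, is a single closing bracket,
begins with a dollar, or is any other word. -/
inductive WordClass
  | empty : WordClass
  | closingBracket : WordClass
  | startsWithDollar : WordClass
  | other : WordClass

/-- For `k = n - j`, the pair of
`𝒫(𝒯ⁿ) × 𝒫(𝒯ⁿ⁻¹) × ⋯ × 𝒫(𝒯ᵏ⁺¹)` and of
`𝒟ᵏ = ⋃_{r = k+1}^{n} M × {r} × 𝒫(𝒯ⁿ) × ⋯ × 𝒫(𝒯ʳ⁺¹) × Q`, where
`𝒯ᵏ = {ne} ∪ (𝒫(𝒯ⁿ) × ⋯ × 𝒫(𝒯ᵏ⁺¹) × Q × 𝒟ᵏ)`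
(`none` plays the role of `ne`); these sets depend only on the difference `n - k`. -/
def descriptorParts (Q : Type u) : ℕ → Type u × Type u
  | 0 => (PUnit, PEmpty)
  | j + 1 =>
    ((descriptorParts Q j).1 ×
        Set (Option ((descriptorParts Q j).1 × Q × (descriptorParts Q j).2)),
      (descriptorParts Q j).2 ⊕ (WordClass × (descriptorParts Q j).1 × Q))

/-- The set `𝒯ⁿ⁻ʲ` of run descriptors for `(n - j)`-stacks of an `n`-HOPAD with state set `Q`. -/
def RunDescriptor (Q : Type u) (j : ℕ) : Type u :=
  Option ((descriptorParts Q j).1 × Q × (descriptorParts Q j).2)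

instance : Finite WordClass :=
  Finite.of_surjective
    (fun i : Fin 4 => (![WordClass.empty, WordClass.closingBracket, WordClass.startsWithDollar,
      WordClass.other] : Fin 4 → WordClass) i)
    (fun x => by cases x <;> [exact ⟨0, rfl⟩; exact ⟨1, rfl⟩; exact ⟨2, rfl⟩; exact ⟨3, rfl⟩])

theorem finite_descriptorParts (Q : Type u) [Finite Q] :
    ∀ j : ℕ, Finite (descriptorParts Q j).1 ∧ Finite (descriptorParts Q j).2
  | 0 => ⟨inferInstanceAs (Finite PUnit), inferInstanceAs (Finite PEmpty)⟩
  | j + 1 => by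
    obtain ⟨h1, h2⟩ := finite_descriptorParts Q j
    exact ⟨inferInstanceAs (Finite ((descriptorParts Q j).1 ×
        Set (Option ((descriptorParts Q j).1 × Q × (descriptorParts Q j).2)))),
      inferInstanceAs (Finite ((descriptorParts Q j).2 ⊕
        (WordClass × (descriptorParts Q j).1 × Q)))⟩

instance finite_runDescriptor (Q : Type u) [Finite Q] (j : ℕ) : Finite (RunDescriptor Q j) := by
  obtain ⟨h1, h2⟩ := finite_descriptorParts Q j
  exact inferInstanceAs (Finite (Option ((descriptorParts Q j).1 × Q × (descriptorParts Q j).2)))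

/-- `N = 2 + 2^M` with `M = ∑_{i=0}^{n} |𝒯ⁱ|`. -/
noncomputable def bigN (n : ℕ) (Q : Type*) : ℕ :=
  2 + 2 ^ (∑ j ∈ Finset.range (n + 1), Nat.card (RunDescriptor Q j))

/-- The words `w_0 = [][` and `w_{k+1} = w_k^N ]^N [`. -/
def wordW (N : ℕ) : ℕ → List Letter
  | 0 => [Letter.opening, Letter.closing, Letter.opening]
  | k + 1 => (List.replicate N (wordW N k)).flatten ++ List.replicate N Letter.closing ++
      [Letter.opening]

/-!
No deterministic higher-order pushdown automaton with data recognizes `U`, by pigeonhole on types of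
stacks.  The first claim concerns an automaton which does recognize `U`; so it follows from the
second one, and the whole work lies in the second one.  That one is proved for words built like
`w_n`, but with a number `N` exceeding the number of the types of stacks defined here.

*Lineages.*  Stacks are written as zippers: a topmost symbol, and for each `l < n` the list of
`l`-stacks under the topmost `l`-stack.  Along a run, the topmost `K`-stack of the last
configuration descends from a topmost `K`-stack of an earlier one (`Up`) if, apart from operations
inside of this stack, the run only makes copies of it and excursions above which return to it
(`Ret`).  Symbols are only multiplied by copying, so when a data value was read only once and is
stored in the topmost `(K+1)`-stack at the end, the topmost `K`-stack has an ancestor which was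
topmost when the value was read (`Reachable.exists_up`).  If all values from a part of the input
with distinct values are still stored in the topmost `(K+1)`-stack, then this whole part was read
while the ancestor of the topmost `K`-stack was topmost (`Reachable.cleanUp`): the stacks
surrounding it were only used for excursions reading nothing.

*Types.*  Such surroundings matter only through a finite amount of information.  Let a word
`$ s` be read from a configuration in search for a value `d` in `s`.  The type of a list of
`l`-stacks records, from which states and on top of which types above it some accepting run finds
`d`, and which returns without reading are possible.  The runs above the list respect types
(`Dominates`), there are finitely many types (`finite_stackTypes`), and a stack storing neither `d`
nor `d'` has the same type when searching for either of them (`stackType_eq_of_fixed`), because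
exchanging the two values is an automorphism of the situation.  Hence, if `d` and `d'` are both lost
from the topmost `K`-stack, and the surroundings of this stack have the same types in the searches
for `d` and for `d'`, then from an accepted continuation `$ s` with `d` in `s` one obtains an
accepted continuation with `d'` in it (`CleanUp.transfer`).

*Losing values.*  Let `w_k` be the word `b_k [`, where `b_k` is the bracket expression `blockWord`.
For `N` exceeding the number of types, `exists_not_stores` shows by induction on `k` that a value
from `b_k` is lost from the topmost `k`-stack after reading `b_k`.  A `0`-stack cannot store both
values of `b_0`.  If everything from `b_{k+1} = (b_k [)^N ]^N` were stored in the topmost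
`(k+1)`-stack, then this part would have been read while an ancestor of the topmost `k`-stack was
topmost, and each of the `N` blocks would lose a value `d_i` from the `k`-stack.  The types agree
for two values `d_i`, `d_j` with `i < j`.  Close the brackets down to the one after block `i`, and
read the dollar.  Now `d_i` has to occur in the continuation, whereas `d_j`, which lies inside of the
closed part, must not occur (`mem_snd_of_mem_langU`), in contradiction to the transfer.

For `k = n`, a value from `b_n` is lost from the whole stack.  After `b_n [ $` it has to occur
again, and it could be exchanged for a value which has never been read.
-/

/-! ### Zippers and lineages of topmost stacks -/

/-- The list of `l`-stacks lying under a topmost `l`-stack, for an unspecified `l < n`.  An entry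
`cons x a r` has a first stack with topmost symbol `x`, under whose topmost `m`-stack lies `a m`,
for `m < l` (the other values of `a` are irrelevant), and further stacks `r`. -/
inductive Below (n : ℕ) (α : Type*)
  | nil : Below n α
  | cons (x : α) (a : Fin n → Below n α) (r : Below n α) : Below n α

namespace Below

variable {n : ℕ} {α : Type*}

/-- Forget everything that is not inside of the topmost `l`-stack. -/
def trunc (l : Fin n) (a : Fin n → Below n α) : Fin n → Below n α :=
  fun m => if m < l then a m else nil

/-- Replace the topmost `l`-stack by the one described by `a'` and the stacks under it by `r`. -/
def join (l : Fin n) (a' : Fin n → Below n α) (r : Below n α) (a : Fin n → Below n α) :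
    Fin n → Below n α :=
  fun m => if m < l then a' m else if m = l then r else a m

/-- Put a copy of the topmost `l`-stack, whose topmost symbol is `x`, under itself. -/
def dup (l : Fin n) (x : α) (a : Fin n → Below n α) : Fin n → Below n α :=
  Function.update a l (cons x (trunc l a) (a l))

/-- The topmost `(l+1)`-stack is taken from `a`, the surrounding from `c`. -/
def splice (l : Fin n) (a c : Fin n → Below n α) : Fin n → Below n α :=
  fun m => if m ≤ l then a m else c m

theorem join_of_lt {l m : Fin n} (h : m < l) (a' r) (a : Fin n → Below n α) :
    join l a' r a m = a' m := by simp [join, h]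

theorem join_self (l : Fin n) (a' r) (a : Fin n → Below n α) : join l a' r a l = r := by
  simp [join]

theorem join_of_gt {l m : Fin n} (h : l < m) (a' r) (a : Fin n → Below n α) :
    join l a' r a m = a m := by simp [join, h.not_gt, h.ne']

theorem dup_self (l : Fin n) (x : α) (a : Fin n → Below n α) :
    dup l x a l = cons x (trunc l a) (a l) := by simp [dup]

theorem dup_of_ne {l m : Fin n} (h : m ≠ l) (x : α) (a : Fin n → Below n α) :
    dup l x a m = a m := by simp [dup, h]

theorem trunc_of_lt {l m : Fin n} (h : m < l) (a : Fin n → Below n α) : trunc l a m = a m := by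
  simp [trunc, h]

theorem splice_of_le {l m : Fin n} (h : m ≤ l) (a c : Fin n → Below n α) :
    splice l a c m = a m := by simp [splice, h]

theorem splice_of_gt {l m : Fin n} (h : l < m) (a c : Fin n → Below n α) :
    splice l a c m = c m := by simp [splice, h.not_ge]

theorem join_below_self (l : Fin n) (a c : Fin n → Below n α) :
    join l a (a l) c = splice l a c := by
  funext m
  rcases lt_trichotomy m l with h | rfl | h
  · rw [join_of_lt h, splice_of_le h.le]
  · rw [join_self, splice_of_le le_rfl]
  · rw [join_of_gt h, splice_of_gt h]

theorem join_trunc (l : Fin n) (a c : Fin n → Below n α) :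
    join l (trunc l a) (a l) c = splice l a c := by
  rw [← join_below_self]
  funext m
  by_cases h : m < l <;> simp [join, trunc, h]

/-- Some symbol with the property `p` occurs in a list of `l`-stacks. -/
def Has (p : α → Prop) : Fin n → Below n α → Prop
  | _, nil => False
  | l, cons x a r => p x ∨ (∃ k, k < l ∧ Has p k (a k)) ∨ Has p l r

/-- Some symbol with the property `p` occurs in the topmost `K`-stack. -/
def TopHas (p : α → Prop) (K : ℕ) (x : α) (a : Fin n → Below n α) : Prop :=
  p x ∨ ∃ m : Fin n, m.val < K ∧ Has p m (a m)

theorem TopHas.mono {p : α → Prop} {K K' : ℕ} (h : K ≤ K') {x : α} {a : Fin n → Below n α} :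
    TopHas p K x a → TopHas p K' x a
  | Or.inl hx => Or.inl hx
  | Or.inr ⟨m, hm, hh⟩ => Or.inr ⟨m, hm.trans_le h, hh⟩

theorem Has.or {p p₁ p₂ : α → Prop} (hp : ∀ x, p x → p₁ x ∨ p₂ x) {l : Fin n}
    {b : Below n α} (h : Has p l b) : Has p₁ l b ∨ Has p₂ l b := by
  induction b generalizing l with
  | nil => exact h.elim
  | cons x a r iha ihr =>
    rcases h with h | ⟨k, hk, h⟩ | h
    · exact (hp x h).imp Or.inl Or.inl
    · exact (iha k h).imp (fun h => Or.inr (Or.inl ⟨k, hk, h⟩))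
        fun h => Or.inr (Or.inl ⟨k, hk, h⟩)
    · exact (ihr h).imp (fun h => Or.inr (Or.inr h)) fun h => Or.inr (Or.inr h)

theorem TopHas.or {p p₁ p₂ : α → Prop} (hp : ∀ x, p x → p₁ x ∨ p₂ x) {K : ℕ} {x : α}
    {a : Fin n → Below n α} : TopHas p K x a → TopHas p₁ K x a ∨ TopHas p₂ K x a
  | Or.inl hx => (hp x hx).imp Or.inl Or.inl
  | Or.inr ⟨m, hm, hh⟩ =>
    (hh.or hp).imp (fun h => Or.inr ⟨m, hm, h⟩) fun h => Or.inr ⟨m, hm, h⟩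

theorem TopHas.congr {p : α → Prop} {K : ℕ} {x : α} {a c : Fin n → Below n α}
    (h : ∀ m : Fin n, m.val < K → a m = c m) : TopHas p K x a → TopHas p K x c
  | Or.inl hx => Or.inl hx
  | Or.inr ⟨m, hm, hh⟩ => Or.inr ⟨m, hm, h m hm ▸ hh⟩

/-- The entry uncovered by a pop operation lay in the list from which it was popped. -/
theorem TopHas.of_join {p : α → Prop} {l : Fin n} {x' : α} {a a' c : Fin n → Below n α}
    {r : Below n α} (hl : a l = cons x' a' r) (h : TopHas p (l + 1) x' (join l a' r c)) :
    Has p l (a l) := by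
  rw [hl, Has]
  rcases h with h | ⟨m, hm, h⟩
  · exact Or.inl h
  · rcases (show m ≤ l from Nat.lt_succ_iff.mp hm).lt_or_eq with h' | rfl
    · rw [join_of_lt h'] at h
      exact Or.inr (Or.inl ⟨m, h', h⟩)
    · rw [join_self] at h
      exact Or.inr (Or.inr h)

theorem TopHas.of_pop {p : α → Prop} {K : ℕ} {l : Fin n} (hK : l.val < K) {x x' : α}
    {a a' : Fin n → Below n α} {r : Below n α} (hl : a l = cons x' a' r)
    (h : TopHas p K x' (join l a' r a)) : TopHas p K x a := by
  by_cases h' : TopHas p (l + 1) x' (join l a' r a)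
  · exact Or.inr ⟨l, hK, of_join hl h'⟩
  · rcases h with h | ⟨m, hm, h⟩
    · exact absurd (Or.inl h) h'
    · rcases le_or_gt m l with h2 | h2
      · exact absurd (Or.inr ⟨m, Nat.lt_succ_of_le h2, h⟩) h'
      · rw [join_of_gt h2] at h
        exact Or.inr ⟨m, hm, h⟩

theorem Has.of_dup {p : α → Prop} {l m : Fin n} {x : α} {a : Fin n → Below n α}
    (h : Has p m (dup l x a m)) : Has p m (a m) ∨ TopHas p (l + 1) x a ∧ m = l := by
  by_cases hm : m = l
  · subst hm
    rw [dup_self, Has] at h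
    refine Or.inr ⟨?_, rfl⟩
    rcases h with h | ⟨k, hk, h⟩ | h
    · exact Or.inl h
    · rw [trunc_of_lt hk] at h
      exact Or.inr ⟨k, Nat.lt_succ_of_lt hk, h⟩
    · exact Or.inr ⟨m, Nat.lt_succ_self _, h⟩
  · rw [dup_of_ne hm] at h
    exact Or.inl h

theorem TopHas.of_dup {p : α → Prop} {K : ℕ} {l : Fin n} {x y : α} {a : Fin n → Below n α}
    (h : TopHas p K y (dup l x a)) (hy : ¬ p y) : TopHas p K x a := by
  rcases h with h | ⟨m, hm, h⟩
  · exact absurd h hy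
  · rcases h.of_dup with h | ⟨h, rfl⟩
    · exact Or.inr ⟨m, hm, h⟩
    · exact h.mono hm

end Below

open Below

/-- A zipper: a state, the topmost symbol, and, for every `l < n`, the list of `l`-stacks
under the topmost `l`-stack inside of the topmost `(l+1)`-stack. -/
structure Zipper (n : ℕ) (α σ : Type*) where
  state : σ
  top : α
  below : Fin n → Below n α

/-- A transition relation of a nondeterministic higher-order pushdown system without input;
a push operation carries the symbol which becomes topmost. -/
abbrev PushdownSystem (n : ℕ) (α σ : Type*) : Type _ := σ → α → σ → StackOp n α → Prop

namespace PushdownSystem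

variable {n : ℕ} {α σ : Type*}

/-- The zipper `E` can be reached from the zipper with the given components. -/
inductive Reach (Δ : PushdownSystem n α σ) (E : Zipper n α σ) :
    σ → α → (Fin n → Below n α) → Prop
  | refl : Reach Δ E E.state E.top E.below
  | pop {q x a q₁ l x' a' r} (hΔ : Δ q x q₁ (.pop l)) (hl : a l = cons x' a' r)
      (h : Reach Δ E q₁ x' (join l a' r a)) : Reach Δ E q x a
  | push {q x a q₁ l y} (hΔ : Δ q x q₁ (.push l y)) (h : Reach Δ E q₁ y (dup l x a)) :
      Reach Δ E q x a

/-- `l`-returns: some run from the zipper with components `q`, `x`, `a` ends by popping an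
`l`-stack whose removal uncovers the very list `a l` of the first zipper (or a copy of it made by
operations on larger stacks); it ends in the state `q'`, and `b` describes the surrounding of the
topmost `(l+1)`-stack at that moment. -/
inductive Ret (Δ : PushdownSystem n α σ) :
    Fin n → σ → α → (Fin n → Below n α) → σ → (Fin n → Below n α) → Prop
  | last {l q x a q'} (hΔ : Δ q x q' (.pop l)) : Ret Δ l q x a q' a
  | pop {l q x a q' b q₁ k x' a' r} (hΔ : Δ q x q₁ (.pop k)) (hk : k < l)
      (hl : a k = cons x' a' r) (h : Ret Δ l q₁ x' (join k a' r a) q' b) : Ret Δ l q x a q' b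
  | push {l q x a q' b q₁ k y} (hΔ : Δ q x q₁ (.push k y)) (hk : k ≠ l)
      (h : Ret Δ l q₁ y (dup k x a) q' b) : Ret Δ l q x a q' b
  | pushRet {l q x a q' b q₁ k y q₂ c} (hΔ : Δ q x q₁ (.push k y)) (hk : l ≤ k)
      (h₁ : Ret Δ k q₁ y (dup k x a) q₂ c) (h₂ : Ret Δ l q₂ x (splice k a c) q' b) :
      Ret Δ l q x a q' b

/-- Some run to `E` has the property that the topmost `K`-stack of `E` descends from the topmost
`K`-stack of the first zipper.  While this stack is not topmost, the run makes an excursion,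
which starts with a push operation and ends with the corresponding return; its first and its last
state are required to be related by `ρ`. -/
inductive Up (Δ : PushdownSystem n α σ) (ρ : σ → σ → Prop) (K : ℕ) (E : Zipper n α σ) :
    σ → α → (Fin n → Below n α) → Prop
  | refl : Up Δ ρ K E E.state E.top E.below
  | pop {q x a q₁ l x' a' r} (hΔ : Δ q x q₁ (.pop l)) (hK : l.val < K) (hl : a l = cons x' a' r)
      (h : Up Δ ρ K E q₁ x' (join l a' r a)) : Up Δ ρ K E q x a
  | push {q x a q₁ l y} (hΔ : Δ q x q₁ (.push l y)) (h : Up Δ ρ K E q₁ y (dup l x a)) :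
      Up Δ ρ K E q x a
  | pushRet {q x a q₁ l y q₂ c} (hΔ : Δ q x q₁ (.push l y)) (hK : K ≤ l.val) (hρ : ρ q q₂)
      (h₁ : Ret Δ l q₁ y (dup l x a) q₂ c) (h₂ : Up Δ ρ K E q₂ x (splice l a c)) :
      Up Δ ρ K E q x a

variable {Δ : PushdownSystem n α σ} {ρ : σ → σ → Prop} {E : Zipper n α σ}

theorem Ret.reach {l q x a q' b} (h : Ret Δ l q x a q' b) {x' a' r} (hl : a l = cons x' a' r)
    (hE : Reach Δ E q' x' (join l a' r b)) : Reach Δ E q x a := by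
  induction h generalizing x' a' r with
  | last hΔ => exact .pop hΔ hl hE
  | pop hΔ hk hk' _ ih =>
    exact .pop hΔ hk' (ih (by rw [join_of_gt hk, hl]) hE)
  | push hΔ hk _ ih => exact .push hΔ (ih (by rw [dup_of_ne hk.symm, hl]) hE)
  | pushRet hΔ hk _ _ ih₁ ih₂ =>
    refine .push hΔ (ih₁ (dup_self _ _ _) ?_)
    rw [join_trunc]
    exact ih₂ (by rw [splice_of_le hk, hl]) hE

theorem Ret.up {l q x a q' b} (h : Ret Δ l q x a q' b) {K : ℕ} (hK : l.val < K) {x' a' r}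
    (hl : a l = cons x' a' r)
    (hE : Up Δ (fun _ _ => True) K E q' x' (join l a' r b)) :
    Up Δ (fun _ _ => True) K E q x a := by
  induction h generalizing x' a' r with
  | last hΔ => exact .pop hΔ hK hl hE
  | pop hΔ hk hk' _ ih =>
    exact .pop hΔ (lt_trans hk hK) hk' (ih hK (by rw [join_of_gt hk, hl]) hE)
  | push hΔ hk _ ih => exact .push hΔ (ih hK (by rw [dup_of_ne hk.symm, hl]) hE)
  | @pushRet l q x a q' b q₁ k y q₂ c hΔ hk h₁ _ ih₁ ih₂ =>
    have h2 := ih₂ hK (by rw [splice_of_le hk, hl]) hE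
    rcases lt_or_ge k.val K with hkK | hkK
    · refine .push hΔ (ih₁ hkK (dup_self _ _ _) ?_)
      rwa [join_trunc]
    · exact .pushRet hΔ hkK trivial h₁ h2

theorem Up.reach {K : ℕ} {q x a} (h : Up Δ ρ K E q x a) : Reach Δ E q x a := by
  induction h with
  | refl => exact .refl
  | pop hΔ _ hl _ ih => exact .pop hΔ hl ih
  | push hΔ _ ih => exact .push hΔ ih
  | pushRet hΔ _ _ h₁ _ ih =>
    refine .push hΔ (h₁.reach (dup_self _ _ _) ?_)
    rwa [join_trunc]

theorem Reach.up {q x a} (h : Reach Δ E q x a) : Up Δ ρ n E q x a := by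
  induction h with
  | refl => exact .refl
  | @pop _ _ _ _ l _ _ _ hΔ hl _ ih => exact .pop hΔ l.isLt hl ih
  | push hΔ _ ih => exact .push hΔ ih

theorem Up.mono {K K' : ℕ} (hK : K ≤ K') {q x a} (h : Up Δ ρ K E q x a) :
    Up Δ (fun _ _ => True) K' E q x a := by
  induction h with
  | refl => exact .refl
  | pop hΔ h hl _ ih => exact .pop hΔ (h.trans_le hK) hl ih
  | push hΔ _ ih => exact .push hΔ ih
  | @pushRet _ _ _ _ l _ _ _ hΔ _ _ h₁ _ ih =>
    rcases lt_or_ge l.val K' with h' | h'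
    · refine .push hΔ (h₁.up h' (dup_self _ _ _) ?_)
      rwa [join_trunc]
    · exact .pushRet hΔ h' trivial h₁ ih

theorem Reach.trans {F : Zipper n α σ} {q x a} (h : Reach Δ F q x a)
    (hF : Reach Δ E F.state F.top F.below) : Reach Δ E q x a := by
  induction h with
  | refl => exact hF
  | pop hΔ hl _ ih => exact .pop hΔ hl ih
  | push hΔ _ ih => exact .push hΔ ih

/-- Runs that consist of several `K`-returns, each uncovering the next `K`-stack, and of a run
in which the topmost `K`-stack of `E` descends from the one uncovered last. -/
inductive Chain (Δ : PushdownSystem n α σ) (K : Fin n) (E : Zipper n α σ) :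
    σ → α → (Fin n → Below n α) → Prop
  | up {q x a} (h : Up Δ (fun _ _ => True) K E q x a) : Chain Δ K E q x a
  | ret {q x a q' b x' a' r} (h : Ret Δ K q x a q' b) (hl : a K = cons x' a' r)
      (h' : Chain Δ K E q' x' (join K a' r b)) : Chain Δ K E q x a

theorem Chain.up_succ {K : Fin n} {q x a} (h : Chain Δ K E q x a) :
    Up Δ (fun _ _ => True) (K + 1) E q x a := by
  induction h with
  | up h => exact h.mono (Nat.le_succ _)
  | ret h hl _ ih => exact h.up (Nat.lt_succ_self _) hl ih

/-- If the topmost `(K+1)`-stack of the last zipper descends from the topmost `(K+1)`-stack of the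
first one, then its topmost `K`-stack descends either from the topmost `K`-stack of the first
zipper or from one which is uncovered by a return. -/
theorem Up.chain {K : Fin n} {q x a} (h : Up Δ ρ (K + 1) E q x a) : Chain Δ K E q x a := by
  induction h with
  | refl => exact .up .refl
  | @pop q x a q₁ l x' a' r hΔ hlK hl _ ih =>
    rcases (show l ≤ K from Nat.lt_succ_iff.mp hlK).lt_or_eq with h | rfl
    · cases ih with
      | up ih => exact .up (.pop hΔ h hl ih)
      | ret ih hK ih' =>
        rw [join_of_gt h] at hK
        exact .ret (.pop hΔ h hl ih) hK ih'
    · exact .ret (.last hΔ) hl ih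
  | @push q x a q₁ l y hΔ _ ih =>
    cases ih with
    | up ih => exact .up (.push hΔ ih)
    | ret ih hK ih' =>
      by_cases hl : l = K
      · subst hl
        rw [dup_self] at hK
        cases hK
        rw [join_trunc] at ih'
        cases ih' with
        | up ih' => exact .up (.pushRet hΔ le_rfl trivial ih ih')
        | ret ih₁ hK ih₂ =>
          rw [splice_of_le le_rfl] at hK
          exact .ret (.pushRet hΔ le_rfl ih ih₁) hK ih₂
      · rw [dup_of_ne (Ne.symm hl)] at hK
        exact .ret (.push hΔ hl ih) hK ih'
  | @pushRet q x a q₁ l y q₂ c hΔ hlK _ h₁ _ ih =>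
    have hKl : K ≤ l := (Nat.lt_of_succ_le hlK).le
    cases ih with
    | up ih => exact .up (.pushRet hΔ hKl trivial h₁ ih)
    | ret ih hK ih' =>
      rw [splice_of_le hKl] at hK
      exact .ret (.pushRet hΔ hKl h₁ ih) hK ih'

section Counting

variable {p : α → Prop} {ct : σ → ℕ}

/-- `ct` counts (at least) the push operations which place a symbol with the property `p`. -/
def Counts (Δ : PushdownSystem n α σ) (p : α → Prop) (ct : σ → ℕ) : Prop :=
  (∀ q x q' op, Δ q x q' op → ct q ≤ ct q') ∧
    ∀ q x q' l y, Δ q x q' (.push l y) → p y → ct q < ct q'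

theorem Ret.count_le (hc : Counts Δ p ct) {l q x a q' b} (h : Ret Δ l q x a q' b) :
    ct q ≤ ct q' := by
  induction h with
  | last hΔ => exact hc.1 _ _ _ _ hΔ
  | pop hΔ _ _ _ ih => exact (hc.1 _ _ _ _ hΔ).trans ih
  | push hΔ _ _ ih => exact (hc.1 _ _ _ _ hΔ).trans ih
  | pushRet hΔ _ _ _ ih₁ ih₂ => exact (hc.1 _ _ _ _ hΔ).trans (ih₁.trans ih₂)

theorem Up.count_le (hc : Counts Δ p ct) {K : ℕ} {q x a} (h : Up Δ ρ K E q x a) :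
    ct q ≤ ct E.state := by
  induction h with
  | refl => exact le_rfl
  | pop hΔ _ _ _ ih => exact (hc.1 _ _ _ _ hΔ).trans ih
  | push hΔ _ ih => exact (hc.1 _ _ _ _ hΔ).trans ih
  | pushRet hΔ _ _ h₁ _ ih => exact (hc.1 _ _ _ _ hΔ).trans ((h₁.count_le hc).trans ih)

/-- What occurs in the topmost `K`-stack was in its ancestor, or has been pushed meanwhile. -/
theorem Up.topHas (hc : Counts Δ p ct) {K : ℕ} {q x a} (h : Up Δ ρ K E q x a)
    (hE : TopHas p K E.top E.below) (hct : ct E.state ≤ ct q) : TopHas p K x a := by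
  induction h with
  | refl => exact hE
  | pop hΔ hK hl _ ih => exact .of_pop hK hl (ih (hct.trans (hc.1 _ _ _ _ hΔ)))
  | push hΔ h ih =>
    exact .of_dup (ih (hct.trans (hc.1 _ _ _ _ hΔ))) fun hy =>
      (hc.2 _ _ _ _ _ hΔ hy).not_ge ((h.count_le hc).trans hct)
  | @pushRet q x a q₁ l y q₂ c hΔ hK _ h₁ _ ih =>
    exact (ih (hct.trans ((hc.1 _ _ _ _ hΔ).trans (h₁.count_le hc)))).congr
      fun m hm => splice_of_le (hm.le.trans hK) _ _

/-- If a symbol placed by a push operation is still in the topmost `(K+1)`-stack of `E`, then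
the topmost `K`-stack of `E` descends from the `K`-stack which was topmost when the symbol was
placed. -/
theorem Reach.up_of_topHas (hc : Counts Δ p ct) {q x a} (h : Reach Δ E q x a)
    (hct : ct E.state ≤ ct q) (ha : ∀ m, ¬ Has p m (a m)) {K : ℕ}
    (hE : TopHas p (K + 1) E.top E.below) : Up Δ (fun _ _ => True) K E q x a := by
  rcases le_or_gt n K with hK | hK
  · exact h.up.mono (ρ := fun _ _ => True) hK
  · refine Nat.decreasingInduction' (P := fun K' => Up Δ (fun _ _ => True) K' E q x a)
      (fun K' hK' hKK' ih => ?_) hK.le h.up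
    cases (Up.chain (K := ⟨K', hK'⟩) ih) with
    | up h => exact h
    | @ret _ _ _ q' b x' a' r h hl h' =>
      have := h'.up_succ.topHas hc (hE.mono (Nat.succ_le_succ hKK'))
        (hct.trans (h.count_le hc))
      exact absurd (this.of_join hl) (ha _)

end Counting

end PushdownSystem

/-! ### Finitely many types of stacks -/

namespace PushdownSystem

variable {n : ℕ} {α σ ι : Type*}

/-- The sets of stacks that serve as types.  The first component selects one of several pushdown
systems, with respect to which the stack is considered. -/
abbrev TypeEnv (n : ℕ) (α ι : Type*) : Type _ := Fin n → Set (ι × Below n α)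

/-- What a run may achieve: `none` stands for reaching an accepting state, and `some (m, R, q)` for
an `m`-return in the state `q` such that the surrounding stacks then have the types given
by `R`. -/
abbrev Outcome (n : ℕ) (α σ ι : Type*) : Type _ := Option (Fin n × TypeEnv n α ι × σ)

/-- A run descriptor: types of the surrounding stacks, the state in which the run starts, and
an outcome. -/
abbrev Descriptor (n : ℕ) (α σ ι : Type*) : Type _ := TypeEnv n α ι × σ × Outcome n α σ ι

/-- The `i`-th system has a run with the given outcome. -/
def Achieves (Δ : ι → PushdownSystem n α σ) (F : Set σ) (i : ι) (q : σ) (x : α)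
    (a : Fin n → Below n α) : Outcome n α σ ι → Prop
  | none => ∃ E : Zipper n α σ, E.state ∈ F ∧ Reach (Δ i) E q x a
  | some (m, R, q') => ∃ b, Ret (Δ i) m q x a q' b ∧ ∀ k, m < k → (i, b k) ∈ R k

/-- The lists of `l`-stacks satisfying a descriptor: when the first of these stacks is uncovered in
the given state, within a surrounding of the given types, then the outcome can be achieved. -/
def Sat (Δ : ι → PushdownSystem n α σ) (F : Set σ) (l : Fin n) (s : Descriptor n α σ ι) :
    Set (ι × Below n α) :=
  {z | ∃ x a r, z.2 = cons x a r ∧ ∀ c : Fin n → Below n α, (∀ k, l < k → (z.1, c k) ∈ s.1 k) →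
    Achieves Δ F z.1 s.2.1 x (join l a r c) s.2.2}

/-- Types for the levels below `l` from `P`, type `X` for the level `l`, and types for the levels
above `l` from `R`. -/
def mix (l : Fin n) (P : TypeEnv n α ι) (X : Set (ι × Below n α)) (R : TypeEnv n α ι) :
    TypeEnv n α ι :=
  fun k => if k < l then P k else if k = l then X else R k

/-- Forget the types for all levels up to `l`. -/
def above (l : Fin n) (P : TypeEnv n α ι) : TypeEnv n α ι :=
  fun k => if l < k then P k else Set.univ

theorem above_of_lt {l k : Fin n} (h : l < k) (P : TypeEnv n α ι) : above l P k = P k := by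
  simp [above, h]

/-- Derivability of a run descriptor for a topmost symbol.  The derivations depend on the
surrounding stacks only through their types; for a stack that a push operation puts into the
surrounding, an arbitrary set of descriptors derivable for it may be used. -/
inductive Derives (Δ : ι → PushdownSystem n α σ) (F : Set σ) (i : ι) :
    α → TypeEnv n α ι → σ → Outcome n α σ ι → Prop
  | accept {x P q} (hq : q ∈ F) : Derives Δ F i x P q none
  | last {x P q m q' R} (hΔ : Δ i q x q' (.pop m)) (hR : ∀ k, m < k → P k ⊆ R k) :
      Derives Δ F i x P q (some (m, R, q'))
  | pop {x P q l q₁ o} (hΔ : Δ i q x q₁ (.pop l)) (hP : P l ⊆ Sat Δ F l (above l P, q₁, o))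
      (ho : ∀ m R q', o = some (m, R, q') → l < m) : Derives Δ F i x P q o
  | push {x P q l y q₁ o} (hΔ : Δ i q x q₁ (.push l y))
      (ho : ∀ m R q', o = some (m, R, q') → l ≠ m) (S : Set (Descriptor n α σ ι))
      (hS : ∀ s ∈ S, Derives Δ F i x (mix l P (P l) s.1) s.2.1 s.2.2)
      (h : Derives Δ F i y (Function.update P l (⋂ s ∈ S, Sat Δ F l s)) q₁ o) :
      Derives Δ F i x P q o
  | pushRet {x P q l y q₁ R q₂ m R' q'} (hΔ : Δ i q x q₁ (.push l y)) (hm : m ≤ l)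
      (S : Set (Descriptor n α σ ι))
      (hS : ∀ s ∈ S, Derives Δ F i x (mix l P (P l) s.1) s.2.1 s.2.2)
      (h₁ : Derives Δ F i y (Function.update P l (⋂ s ∈ S, Sat Δ F l s)) q₁ (some (l, R, q₂)))
      (h₂ : Derives Δ F i x (mix l P (P l) R) q₂ (some (m, R', q'))) :
      Derives Δ F i x P q (some (m, R', q'))

/-- The descriptors which may contribute to a type of lists of `l`-stacks, when the types of the
higher levels are those in `G`. -/
def Admissible (G : Fin n → Set (Set (ι × Below n α))) (l : Fin n) :
    Set (Descriptor n α σ ι) :=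
  {s | (∀ k, (l < k → s.1 k ∈ G k) ∧ (¬ l < k → s.1 k = Set.univ)) ∧
    ∀ m R q', s.2.2 = some (m, R, q') →
      l < m ∧ ∀ k, (m < k → R k ∈ G k) ∧ (¬ m < k → R k = Set.univ)}

/-- The types of lists of `l`-stacks. -/
inductive IsStackType (Δ : ι → PushdownSystem n α σ) (F : Set σ) :
    Fin n → Set (ι × Below n α) → Prop
  | inter (l : Fin n) (S : Set (Descriptor n α σ ι))
      (hP : ∀ s ∈ S, ∀ k, l < k → IsStackType Δ F k (s.1 k))
      (hP' : ∀ s ∈ S, ∀ k, ¬ l < k → s.1 k = Set.univ)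
      (hm : ∀ s ∈ S, ∀ m R q', s.2.2 = some (m, R, q') → l < m)
      (hR : ∀ s ∈ S, ∀ m R q', s.2.2 = some (m, R, q') → ∀ k, m < k → IsStackType Δ F k (R k))
      (hR' : ∀ s ∈ S, ∀ m R q', s.2.2 = some (m, R, q') → ∀ k, ¬ m < k → R k = Set.univ) :
      IsStackType Δ F l (⋂ s ∈ S, Sat Δ F l s)

variable (Δ : ι → PushdownSystem n α σ) (F : Set σ)

/-- The types of each level, as a family of sets. -/
def stackTypes (l : Fin n) : Set (Set (ι × Below n α)) := {X | IsStackType Δ F l X}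

theorem mem_stackTypes_iff {l : Fin n} {X : Set (ι × Below n α)} :
    X ∈ stackTypes Δ F l ↔
      ∃ S ⊆ Admissible (σ := σ) (stackTypes Δ F) l, X = ⋂ s ∈ S, Sat Δ F l s := by
  constructor
  · rintro ⟨l, S, hP, hP', hm, hR, hR'⟩
    exact ⟨S, fun s hs => ⟨fun k => ⟨hP s hs k, hP' s hs k⟩, fun m R q' h =>
      ⟨hm s hs m R q' h, fun k => ⟨hR s hs m R q' h k, hR' s hs m R q' h k⟩⟩⟩, rfl⟩
  · rintro ⟨S, hS, rfl⟩
    exact .inter l S (fun s hs k => ((hS hs).1 k).1) (fun s hs k => ((hS hs).1 k).2)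
      (fun s hs m R q' h => ((hS hs).2 m R q' h).1)
      (fun s hs m R q' h k => (((hS hs).2 m R q' h).2 k).1)
      (fun s hs m R q' h k => (((hS hs).2 m R q' h).2 k).2)

theorem finite_admissible [Finite σ] (G : Fin n → Set (Set (ι × Below n α))) (l : Fin n)
    (hG : ∀ k, l < k → (G k).Finite) : (Admissible (σ := σ) G l).Finite := by
  let G' : Fin n → Set (Set (ι × Below n α)) := fun k => {X | l < k ∧ X ∈ G k ∨ X = Set.univ}
  have hG' : ∀ k, (G' k).Finite := fun k => by
    by_cases h : l < k
    · exact ((hG k h).union (Set.finite_singleton Set.univ)).subset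
        fun X hX => hX.imp And.right id
    · exact (Set.finite_singleton Set.univ).subset
        fun X hX => hX.resolve_left fun h' => h h'.1
  have hpi := Set.Finite.pi' hG'
  refine ((hpi.prod (Set.finite_univ.prod (((Set.finite_univ.prod
    (hpi.prod Set.finite_univ)).image some).insert none))).subset ?_ :
      (Admissible (σ := σ) G l).Finite)
  rintro ⟨P, q, o⟩ ⟨h₁, h₂⟩
  refine ⟨fun k => ?_, trivial, ?_⟩
  · by_cases h : l < k
    · exact Or.inl ⟨h, (h₁ k).1 h⟩
    · exact Or.inr ((h₁ k).2 h)
  · match o, h₂ with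
    | none, _ => exact Or.inl rfl
    | some (m, R, q'), h₂ =>
      obtain ⟨hm, h₂⟩ := h₂ m R q' rfl
      refine Or.inr ⟨(m, R, q'), ⟨trivial, fun k => ?_, trivial⟩, rfl⟩
      by_cases h : m < k
      · exact Or.inl ⟨hm.trans h, (h₂ k).1 h⟩
      · exact Or.inr ((h₂ k).2 h)

theorem finite_stackTypes [Finite σ] (l : Fin n) : (stackTypes Δ F l).Finite := by
  induction l using WellFoundedGT.induction with
  | _ l ih =>
    refine (((finite_admissible (σ := σ) _ l ih).finite_subsets).image
      fun S => ⋂ s ∈ S, Sat Δ F l s).subset fun X hX => ?_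
    obtain ⟨S, hS, rfl⟩ := (mem_stackTypes_iff Δ F).mp hX
    exact ⟨S, hS, rfl⟩

/-- The type of a list of `l`-stacks in the `i`-th system. -/
def stackType (i : ι) : Fin n → Below n α → Set (ι × Below n α)
  | _, nil => Set.univ
  | l, cons x a r => ⋂ s ∈ {s ∈ Admissible (stackTypes Δ F) l |
      Derives Δ F i x (mix l (fun k => stackType i k (a k)) (stackType i l r) s.1) s.2.1 s.2.2},
      Sat Δ F l s

theorem stackType_mem (i : ι) (l : Fin n) (b : Below n α) :
    stackType Δ F i l b ∈ stackTypes Δ F l := by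
  rw [mem_stackTypes_iff]
  cases b with
  | nil => exact ⟨∅, Set.empty_subset _, by simp [stackType]⟩
  | cons x a r => exact ⟨_, Set.sep_subset _ _, by rw [stackType]⟩

variable {Δ F}

theorem splice_mem_mix {i : ι} {l : Fin n} {P R : TypeEnv n α ι} {a c : Fin n → Below n α}
    (ha : ∀ m, (i, a m) ∈ P m) (hc : ∀ m, l < m → (i, c m) ∈ R m) (m : Fin n) :
    (i, splice l a c m) ∈ mix l P (P l) R m := by
  rcases lt_trichotomy m l with h | rfl | h
  · rw [splice_of_le h.le]
    simpa [mix, h] using ha m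
  · rw [splice_of_le le_rfl]
    simpa [mix] using ha m
  · rw [splice_of_gt h]
    simpa [mix, h.not_gt, h.ne'] using hc m h

/-- Duplicating a topmost `l`-stack puts into the surrounding a stack which satisfies all
descriptors achieved from it. -/
theorem dup_mem {i : ι} {l : Fin n} {x : α} {P : TypeEnv n α ι} {S : Set (Descriptor n α σ ι)}
    {a : Fin n → Below n α} (ha : ∀ m, (i, a m) ∈ P m)
    (hS : ∀ s ∈ S, ∀ {a : Fin n → Below n α}, (∀ m, (i, a m) ∈ mix l P (P l) s.1 m) →
      Achieves Δ F i s.2.1 x a s.2.2) (m : Fin n) :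
    (i, dup l x a m) ∈ Function.update P l (⋂ s ∈ S, Sat Δ F l s) m := by
  by_cases hm : m = l
  · subst hm
    rw [dup_self, Function.update_self]
    refine Set.mem_iInter₂.mpr fun s hs => ⟨x, _, _, rfl, fun c hc => hS s hs fun k => ?_⟩
    rw [join_trunc]
    exact splice_mem_mix ha hc k
  · rw [dup_of_ne hm, Function.update_of_ne hm]
    exact ha m

/-- Derivable outcomes can be achieved in every surrounding of the given types. -/
theorem Derives.achieves {i : ι} {x : α} {P : TypeEnv n α ι} {q : σ} {o : Outcome n α σ ι}
    (h : Derives Δ F i x P q o) {a : Fin n → Below n α} (ha : ∀ m, (i, a m) ∈ P m) :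
    Achieves Δ F i q x a o := by
  induction h generalizing a with
  | @accept x P q hq => exact ⟨⟨q, x, a⟩, hq, .refl⟩
  | @last x P q m q' R hΔ hR => exact ⟨a, .last hΔ, fun k hk => hR k hk (ha k)⟩
  | @pop x P q l q₁ o hΔ hP ho =>
    obtain ⟨x', a', r, hl, h⟩ := hP (ha l)
    have h := h a fun k hk => by
      change (i, a k) ∈ above l P k
      rw [above_of_lt hk]
      exact ha k
    match o, h, ho with
    | none, ⟨E, hE, h⟩, _ => exact ⟨E, hE, .pop hΔ hl h⟩
    | some (m, R, q'), ⟨b, h, hb⟩, ho => exact ⟨b, .pop hΔ (ho m R q' rfl) hl h, hb⟩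
  | @push x P q l y q₁ o hΔ ho S hS h ihS ih =>
    have h := ih (dup_mem ha fun s hs => ihS s hs)
    match o, h, ho with
    | none, ⟨E, hE, h⟩, _ => exact ⟨E, hE, .push hΔ h⟩
    | some (m, R, q'), ⟨b, h, hb⟩, ho => exact ⟨b, .push hΔ (ho m R q' rfl) h, hb⟩
  | @pushRet x P q l y q₁ R q₂ m R' q' hΔ hm S hS h₁ h₂ ihS ih₁ ih₂ =>
    obtain ⟨c, h, hc⟩ := ih₁ (dup_mem ha fun s hs => ihS s hs)
    obtain ⟨b, h', hb⟩ := ih₂ (splice_mem_mix ha hc)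
    exact ⟨b, .pushRet hΔ hm h h', hb⟩

theorem mix_stackType (i : ι) (l : Fin n) (a' a : Fin n → Below n α) (r : Below n α)
    (R : TypeEnv n α ι) (hR : ∀ k, l < k → R k = stackType Δ F i k (a k)) :
    mix l (fun k => stackType Δ F i k (a' k)) (stackType Δ F i l r) R =
      fun k => stackType Δ F i k (join l a' r a k) := by
  funext k
  rcases lt_trichotomy k l with h | rfl | h
  · simp [mix, h, join_of_lt h]
  · simp [mix, join_self]
  · simp [mix, h.not_gt, h.ne', join_of_gt h, hR k h]

theorem stackType_dup (i : ι) (l : Fin n) (x : α) (a : Fin n → Below n α) :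
    (fun k => stackType Δ F i k (dup l x a k)) =
      Function.update (fun k => stackType Δ F i k (a k)) l
        (⋂ s ∈ {s ∈ Admissible (stackTypes Δ F) l | Derives Δ F i x
          (mix l (fun k => stackType Δ F i k (a k)) (stackType Δ F i l (a l)) s.1) s.2.1 s.2.2},
          Sat Δ F l s) := by
  funext k
  by_cases hk : k = l
  · subst hk
    have : ∀ R : TypeEnv n α ι,
        mix k (fun m => stackType Δ F i m (trunc k a m)) (stackType Δ F i k (a k)) R =
          mix k (fun m => stackType Δ F i m (a m)) (stackType Δ F i k (a k)) R := fun R => by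
      funext m
      by_cases h : m < k <;> simp [mix, h, trunc]
    rw [dup_self, Function.update_self, stackType]
    simp only [this]
  · rw [dup_of_ne hk, Function.update_of_ne hk]

theorem above_admissible {i : ι} {l : Fin n} {a : Fin n → Below n α} {q : σ}
    {o : Outcome n α σ ι}
    (ho : ∀ m R q', o = some (m, R, q') → l < m ∧
      ∀ k, (m < k → R k ∈ stackTypes Δ F k) ∧ (¬ m < k → R k = Set.univ)) :
    (above l (fun k => stackType Δ F i k (a k)), q, o) ∈ Admissible (stackTypes Δ F) l :=
  ⟨fun k => ⟨fun hk => by simpa [above, hk] using stackType_mem Δ F i k (a k),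
    fun hk => by simp [above, hk]⟩, ho⟩

/-- Uncovering a stack whose topmost symbol has a derivable descriptor. -/
theorem stackType_subset_sat {i : ι} {l : Fin n} {a a' : Fin n → Below n α} {x' : α}
    {r : Below n α} (hl : a l = cons x' a' r) {q : σ} {o : Outcome n α σ ι}
    (ho : ∀ m R q', o = some (m, R, q') → l < m ∧
      ∀ k, (m < k → R k ∈ stackTypes Δ F k) ∧ (¬ m < k → R k = Set.univ))
    (h : Derives Δ F i x' (fun k => stackType Δ F i k (join l a' r a k)) q o) :
    stackType Δ F i l (a l) ⊆ Sat Δ F l (above l (fun k => stackType Δ F i k (a k)), q, o) := by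
  rw [hl, stackType]
  refine Set.biInter_subset_of_mem ⟨above_admissible ho, ?_⟩
  rwa [mix_stackType i l a' a r _ fun k hk =>
    above_of_lt hk (fun k => stackType Δ F i k (a k))]

theorem Reach.derives {i : ι} {E : Zipper n α σ} (hE : E.state ∈ F) {q : σ} {x : α}
    {a : Fin n → Below n α} (h : Reach (Δ i) E q x a) :
    Derives Δ F i x (fun k => stackType Δ F i k (a k)) q none := by
  induction h with
  | refl => exact .accept hE
  | pop hΔ hl _ ih =>
    exact .pop hΔ (stackType_subset_sat hl (fun _ _ _ h => nomatch h) ih)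
      (fun _ _ _ h => nomatch h)
  | push hΔ _ ih =>
    rw [stackType_dup] at ih
    exact .push hΔ (fun _ _ _ h => nomatch h) _ (fun s hs => hs.2) ih

theorem Ret.derives {i : ι} {l : Fin n} {q : σ} {x : α} {a : Fin n → Below n α} {q' : σ}
    {b : Fin n → Below n α} (h : Ret (Δ i) l q x a q' b) :
    Derives Δ F i x (fun k => stackType Δ F i k (a k)) q
      (some (l, above l (fun k => stackType Δ F i k (b k)), q')) := by
  induction h with
  | last hΔ => exact .last hΔ fun k hk => by rw [above_of_lt hk]
  | @pop l q x a q' b q₁ k x' a' r hΔ hk hl _ ih =>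
    refine .pop hΔ (stackType_subset_sat hl ?_ ih) ?_
    · rintro m R q'' ⟨⟩
      exact ⟨hk, fun k => ⟨fun hk => by simpa [above, hk] using stackType_mem Δ F i k (b k),
        fun hk => by simp [above, hk]⟩⟩
    · rintro m R q'' ⟨⟩
      exact hk
  | push hΔ hk _ ih =>
    rw [stackType_dup] at ih
    refine .push hΔ ?_ _ (fun s hs => hs.2) ih
    rintro m R q'' ⟨⟩
    exact hk
  | @pushRet l q x a q' b q₁ k y q₂ c hΔ hk h₁ _ ih₁ ih₂ =>
    rw [stackType_dup] at ih₁
    refine .pushRet hΔ hk _ (fun s hs => hs.2) ih₁ ?_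
    rwa [mix_stackType i k a c (a k) _ fun k hk => above_of_lt hk _, join_below_self]

/-- Every list of stacks has its own type. -/
theorem mem_stackType (i : ι) (l : Fin n) (b : Below n α) : (i, b) ∈ stackType Δ F i l b := by
  induction b generalizing l with
  | nil => exact Set.mem_univ _
  | cons x a r iha ihr =>
    rw [stackType]
    refine Set.mem_iInter₂.mpr fun s hs => ⟨x, a, r, rfl, fun c hc => hs.2.achieves fun m => ?_⟩
    rcases lt_trichotomy m l with h | rfl | h
    · rw [join_of_lt h]
      simpa [mix, h] using iha m m
    · rw [join_self]
      simpa [mix] using ihr m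
    · rw [join_of_gt h]
      simpa [mix, h.not_gt, h.ne'] using hc m h

section Transport

/-- Renaming the stack symbols by `θ` turns the transitions of the `i`-th system into transitions
of the `i'`-th one. -/
def Transports (Δ : ι → PushdownSystem n α σ) (θ : α → α) (i i' : ι) : Prop :=
  (∀ q x q' l, Δ i q x q' (.pop l) → Δ i' q (θ x) q' (.pop l)) ∧
    ∀ q x q' l y, Δ i q x q' (.push l y) → Δ i' q (θ x) q' (.push l (θ y))

variable {θ : α → α} {i i' : ι}

theorem Derives.transport (hθ : Transports Δ θ i i') {x : α} {P : TypeEnv n α ι} {q : σ}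
    {o : Outcome n α σ ι} (h : Derives Δ F i x P q o) : Derives Δ F i' (θ x) P q o := by
  induction h with
  | accept hq => exact .accept hq
  | last hΔ hR => exact .last (hθ.1 _ _ _ _ hΔ) hR
  | pop hΔ hP ho => exact .pop (hθ.1 _ _ _ _ hΔ) hP ho
  | push hΔ ho S _ _ ihS ih => exact .push (hθ.2 _ _ _ _ _ hΔ) ho S ihS ih
  | pushRet hΔ hm S _ _ _ ihS ih₁ ih₂ => exact .pushRet (hθ.2 _ _ _ _ _ hΔ) hm S ihS ih₁ ih₂

theorem Derives.transport_of_fixed (hθ : Transports Δ θ i i') {x : α} (hx : θ x = x)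
    {P : TypeEnv n α ι} {q : σ} {o : Outcome n α σ ι} (h : Derives Δ F i x P q o) :
    Derives Δ F i' x P q o := by
  have := h.transport hθ
  rwa [hx] at this

/-- The type of a stack that is not affected by the renaming is the same in both systems. -/
theorem stackType_eq_of_fixed (hθ : Transports Δ θ i i') (hθ' : Transports Δ θ i' i) {l : Fin n}
    {b : Below n α} (hb : ¬ Has (fun x => θ x ≠ x) l b) :
    stackType Δ F i l b = stackType Δ F i' l b := by
  induction b generalizing l with
  | nil => rfl
  | cons x a r iha ihr =>
    simp only [Has, not_or, not_not, not_exists, not_and] at hb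
    obtain ⟨hx, ha, hr⟩ := hb
    have hmix : ∀ R : TypeEnv n α ι,
        mix l (fun k => stackType Δ F i k (a k)) (stackType Δ F i l r) R =
          mix l (fun k => stackType Δ F i' k (a k)) (stackType Δ F i' l r) R := fun R => by
      funext k
      by_cases hk : k < l
      · simp [mix, hk, iha k (ha k hk)]
      · simp [mix, hk, ihr hr]
    have hd : ∀ P q (o : Outcome n α σ ι), Derives Δ F i x P q o ↔ Derives Δ F i' x P q o :=
      fun P q o => ⟨.transport_of_fixed hθ hx, .transport_of_fixed hθ' hx⟩
    simp only [stackType, hmix, hd]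

/-- The stacks in the surrounding `a'`, considered in the `i'`-th system, satisfy all descriptors
in the types of those in the surrounding `a`, considered in the `i`-th system. -/
def Dominates (Δ : ι → PushdownSystem n α σ) (F : Set σ) (i i' : ι)
    (a a' : Fin n → Below n α) : Prop :=
  ∀ m, (i', a' m) ∈ stackType Δ F i m (a m)

variable {a a' : Fin n → Below n α}

theorem Dominates.reach (hθ : Transports Δ θ i i') (ha : Dominates Δ F i i' a a') {x : α}
    (hx : θ x = x) {E : Zipper n α σ} (hE : E.state ∈ F) {q : σ} (h : Reach (Δ i) E q x a) :
    ∃ E' : Zipper n α σ, E'.state ∈ F ∧ Reach (Δ i') E' q x a' :=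
  ((h.derives hE).transport_of_fixed hθ hx).achieves ha

theorem Dominates.ret (hθ : Transports Δ θ i i') (ha : Dominates Δ F i i' a a') {x : α}
    (hx : θ x = x) {l : Fin n} {q q' : σ} {b : Fin n → Below n α} (h : Ret (Δ i) l q x a q' b) :
    ∃ b', Ret (Δ i') l q x a' q' b' ∧ ∀ m, l < m → (i', b' m) ∈ stackType Δ F i m (b m) := by
  obtain ⟨b', h', hb⟩ := (h.derives.transport_of_fixed hθ hx).achieves ha
  refine ⟨b', h', fun m hm => ?_⟩
  have := hb m hm
  rwa [above_of_lt hm] at this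

theorem Dominates.dup (hθ : Transports Δ θ i i') (ha : Dominates Δ F i i' a a') {x : α}
    (hx : θ x = x) (l : Fin n) : Dominates Δ F i i' (dup l x a) (dup l x a') := by
  have h := dup_mem (Δ := Δ) (F := F) (i := i') (l := l) (x := x) (a := a')
    (P := fun k => stackType Δ F i k (a k)) ha (S := {s ∈ Admissible (stackTypes Δ F) l |
      Derives Δ F i x (mix l (fun k => stackType Δ F i k (a k)) (stackType Δ F i l (a l)) s.1)
        s.2.1 s.2.2}) fun s hs _ h => (hs.2.transport_of_fixed hθ hx).achieves h
  rw [← stackType_dup] at h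
  exact h

end Transport

end PushdownSystem

/-! ### Stacks as zippers -/

namespace HStack

variable {n : ℕ} {Γ D : Type*}

/-- Elementwise representation of a list of stacks. -/
def RepList {H α : Type*} (R : H → α → (Fin n → Below n α) → Prop) : List H → Below n α → Prop
  | [], .nil => True
  | t :: r, .cons x a b => R t x a ∧ RepList R r b
  | _, _ => False

/-- The nonempty `l`-stack `s` has the topmost symbol `x`, and under it the stacks `a`. -/
def Rep : (l : ℕ) → l ≤ n → HStack Γ D l → Γ × Option D → (Fin n → Below n (Γ × Option D)) → Prop
  | 0, _, s, x, _ => s = x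
  | l + 1, h, s, x, a => ∃ t r, items s = t :: r ∧ Rep l (Nat.le_of_succ_le h) t x a ∧
      RepList (Rep l (Nat.le_of_succ_le h)) r (a ⟨l, h⟩)

theorem Rep.congr {l : ℕ} {h : l ≤ n} {s : HStack Γ D l} {x : Γ × Option D}
    {a c : Fin n → Below n (Γ × Option D)} (hs : Rep l h s x a)
    (hac : ∀ m : Fin n, m.val < l → a m = c m) : Rep l h s x c := by
  induction l with
  | zero => exact hs
  | succ l ih =>
    obtain ⟨t, r, hi, ht, hr⟩ := hs
    exact ⟨t, r, hi, ih ht fun m hm => hac m (Nat.lt_succ_of_lt hm),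
      hac ⟨l, h⟩ (Nat.lt_succ_self l) ▸ hr⟩

theorem Rep.top0_eq {l : ℕ} {h : l ≤ n} {s : HStack Γ D l} {x : Γ × Option D}
    {a : Fin n → Below n (Γ × Option D)} (hs : Rep l h s x a) : top0 l s = some x := by
  induction l with
  | zero => exact congrArg some hs
  | succ l ih =>
    obtain ⟨t, r, hi, ht, -⟩ := hs
    rw [top0, hi]
    exact ih ht

theorem Rep.setTop {l : ℕ} {h : l ≤ n} {s : HStack Γ D l} {x : Γ × Option D}
    {a : Fin n → Below n (Γ × Option D)} (hs : Rep l h s x a) (y : Γ × Option D) :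
    Rep l h (setTop y l s) y a := by
  induction l with
  | zero => rfl
  | succ l ih =>
    obtain ⟨t, r, hi, ht, hr⟩ := hs
    exact ⟨HStack.setTop y l t, r, by rw [HStack.setTop, hi]; rfl, ih ht, hr⟩

theorem RepList.wellFormed {l : ℕ} {h : l ≤ n}
    (ih : ∀ (s : HStack Γ D l) x a, Rep l h s x a → WellFormed l s) {r : List (HStack Γ D l)}
    {b : Below n (Γ × Option D)} (hr : RepList (Rep l h) r b) : ∀ t ∈ r, WellFormed l t := by
  induction r generalizing b with
  | nil => simp
  | cons t r ihr =>
    cases b with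
    | nil => exact hr.elim
    | cons x a b =>
      rw [List.forall_mem_cons]
      exact ⟨ih _ _ _ hr.1, ihr hr.2⟩

theorem Rep.wellFormed {l : ℕ} {h : l ≤ n} {s : HStack Γ D l} {x : Γ × Option D}
    {a : Fin n → Below n (Γ × Option D)} (hs : Rep l h s x a) : WellFormed l s := by
  induction l generalizing x a with
  | zero => trivial
  | succ l ih =>
    obtain ⟨t, r, hi, ht, hr⟩ := hs
    rw [WellFormed, hi, List.forall_mem_cons]
    exact ⟨List.cons_ne_nil _ _, ih ht, RepList.wellFormed (fun _ _ _ => ih) hr⟩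

theorem rep_single (l : ℕ) (h : l ≤ n) (x : Γ × Option D) :
    Rep l h (single x l) x fun _ => .nil := by
  induction l with
  | zero => rfl
  | succ l ih => exact ⟨single x l, [], rfl, ih _, trivial⟩

theorem Rep.push {l : ℕ} {h : l ≤ n} {s : HStack Γ D l} {x : Γ × Option D}
    {a : Fin n → Below n (Γ × Option D)} (hs : Rep l h s x a) (y : Γ × Option D) {k : Fin n}
    (hk : k.val < l) : ∃ s', HStack.push (k + 1) y l s = some s' ∧ Rep l h s' y (dup k x a) := by
  induction l with
  | zero => exact absurd hk (Nat.not_lt_zero _)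
  | succ l ih =>
    obtain ⟨t, r, hi, ht, hr⟩ := hs
    rw [HStack.push, hi]
    by_cases hkl : k.val = l
    · obtain rfl : k = ⟨l, h⟩ := Fin.ext hkl
      refine ⟨(HStack.setTop y l t :: t :: r : List (HStack Γ D l)), by simp only [if_true], _, _,
        rfl, (ht.setTop y).congr fun m hm => ?_, ?_⟩
      · rw [dup_of_ne (Fin.ne_of_lt hm)]
      · rw [dup_self]
        exact ⟨ht.congr fun m hm => (trunc_of_lt hm a).symm, hr⟩
    · obtain ⟨t', ht', hrep⟩ := ih ht (by omega)
      refine ⟨_, by simp only [Nat.add_right_cancel_iff, hkl, if_false, ht']; rfl, t', r, rfl,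
        hrep, ?_⟩
      rwa [dup_of_ne fun h => hkl (congrArg Fin.val h).symm]

theorem Rep.pop {l : ℕ} {h : l ≤ n} {s : HStack Γ D l} {x : Γ × Option D}
    {a : Fin n → Below n (Γ × Option D)} (hs : Rep l h s x a) {k : Fin n} (hk : k.val < l)
    {x' : Γ × Option D} {a' : Fin n → Below n (Γ × Option D)} {r' : Below n (Γ × Option D)}
    (ha : a k = .cons x' a' r') :
    ∃ s', HStack.pop (k + 1) l s = some s' ∧ Rep l h s' x' (join k a' r' a) := by
  induction l with
  | zero => exact absurd hk (Nat.not_lt_zero _)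
  | succ l ih =>
    obtain ⟨t, r, hi, ht, hr⟩ := hs
    rw [HStack.pop, hi]
    by_cases hkl : k.val = l
    · obtain rfl : k = ⟨l, h⟩ := Fin.ext hkl
      rw [ha] at hr
      match r, hr with
      | t' :: r, hr =>
        refine ⟨_, by simp only [if_true], t', r, rfl, hr.1.congr fun m hm => ?_, ?_⟩
        · rw [join_of_lt hm]
        · rw [join_self]
          exact hr.2
    · obtain ⟨t', ht', hrep⟩ := ih ht (by omega)
      refine ⟨_, by simp only [Nat.add_right_cancel_iff, hkl, if_false, ht']; rfl, t', r, rfl,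
        hrep, ?_⟩
      rwa [join_of_gt (Fin.lt_def.mpr (by simp only; omega))]

theorem Rep.not_wellFormed_of_pop {l : ℕ} {h : l ≤ n} {s s' : HStack Γ D l} {x : Γ × Option D}
    {a : Fin n → Below n (Γ × Option D)} (hs : Rep l h s x a) {k : Fin n}
    (ha : a k = .nil) (hs' : HStack.pop (k + 1) l s = some s') : ¬ WellFormed l s' := by
  induction l with
  | zero => exact absurd hs' (by simp [HStack.pop])
  | succ l ih =>
    obtain ⟨t, r, hi, ht, hr⟩ := hs
    rw [HStack.pop, hi] at hs'
    intro hwf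
    by_cases hkl : k.val = l
    · obtain rfl : k = ⟨l, h⟩ := Fin.ext hkl
      rw [ha] at hr
      match r, hr with
      | [], _ =>
        simp only [if_true] at hs'
        cases Option.some.inj hs'
        exact hwf.1 rfl
    · simp only [Nat.add_right_cancel_iff, hkl, if_false] at hs'
      obtain ⟨t', ht', rfl⟩ := Option.map_eq_some_iff.mp hs'
      exact ih ht ht' (hwf.2 t' List.mem_cons_self)

end HStack

/-! ### The automaton as a pushdown system -/

namespace HOPAD

open PushdownSystem HStack

variable {n : ℕ} {A Γ Q : Type*} {D : Type*}

/-- A transition of the automaton with label `ℓ`, if `x` is the topmost symbol. -/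
def Fires (M : HOPAD n A Γ Q) (q : Q) (x : Γ × Option D) (ℓ : Option (A × D)) (q' : Q) :
    StackOp n (Γ × Option D) → Prop
  | .pop k => M.trans q x.1 (ℓ.map Prod.fst) = some (q', .pop k) ∧
      (ℓ.map Prod.snd = none ∨ ℓ.map Prod.snd = x.2)
  | .push k y => M.trans q x.1 (ℓ.map Prod.fst) = some (q', .push k y.1) ∧ y.2 = ℓ.map Prod.snd

/-- The automaton as a pushdown system whose states record the word read so far. -/
def wordSystem (M : HOPAD n A Γ Q) (D : Type*) :
    PushdownSystem n (Γ × Option D) (Q × List (A × D)) :=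
  fun q x q' op => ∃ ℓ : Option (A × D), q'.2 = q.2 ++ ℓ.toList ∧ M.Fires q.1 x ℓ q'.1 op

variable {M : HOPAD n A Γ Q}

theorem reach_of_isRun {R : Steps n A Γ Q D} {c : Config n Γ Q D} (hR : M.IsRun c R)
    {x : Γ × Option D} {a : Fin n → Below n (Γ × Option D)} (hc : Rep n le_rfl c.stack x a)
    (w : List (A × D)) :
    ∃ E : Zipper n (Γ × Option D) (Q × List (A × D)),
      E.state = ((Steps.last c R).state, w ++ Steps.word R) ∧
        Reach (M.wordSystem D) E (c.state, w) x a := by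
  induction R generalizing c x a w with
  | nil => exact ⟨⟨(c.state, w), x, a⟩, by simp [Steps.last, Steps.word], .refl⟩
  | cons s R ih =>
    obtain ⟨ℓ, c'⟩ := s
    obtain ⟨⟨α, d', op, htop, htr, hop⟩, hR⟩ := hR
    rw [hc.top0_eq, Option.some.injEq] at htop
    subst htop
    have hw : w ++ Steps.word ((ℓ, c') :: R) = (w ++ ℓ.toList) ++ Steps.word R := by
      cases ℓ <;> simp [Steps.word]
    have hlast : Steps.last c ((ℓ, c') :: R) = Steps.last c' R := rfl
    rw [hw, hlast]
    cases op with
    | pop k =>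
      obtain ⟨hpop, hd⟩ := hop
      cases ha : a k with
      | nil => exact absurd c'.wf (hc.not_wellFormed_of_pop ha hpop)
      | cons x' a' r =>
        obtain ⟨s', hs', hrep⟩ := hc.pop k.isLt ha
        obtain rfl := Option.some.inj (hs'.symm.trans hpop)
        obtain ⟨E, hE, h⟩ := ih hR hrep (w ++ ℓ.toList)
        exact ⟨E, hE, .pop ⟨ℓ, rfl, htr, hd⟩ ha h⟩
    | push k β =>
      obtain ⟨s', hs', hrep⟩ := hc.push (β, ℓ.map Prod.snd) k.isLt
      obtain rfl := Option.some.inj (hs'.symm.trans hop)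
      obtain ⟨E, hE, h⟩ := ih hR hrep (w ++ ℓ.toList)
      exact ⟨E, hE, .push (y := (β, ℓ.map Prod.snd)) ⟨ℓ, rfl, htr, rfl⟩ h⟩

theorem isRun_of_reach {E : Zipper n (Γ × Option D) (Q × List (A × D))} {q : Q × List (A × D)}
    {x : Γ × Option D} {a : Fin n → Below n (Γ × Option D)} (h : Reach (M.wordSystem D) E q x a)
    {c : Config n Γ Q D} (hq : c.state = q.1) (hc : Rep n le_rfl c.stack x a) :
    ∃ R : Steps n A Γ Q D, M.IsRun c R ∧ (Steps.last c R).state = E.state.1 ∧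
      E.state.2 = q.2 ++ Steps.word R := by
  induction h generalizing c with
  | refl => exact ⟨[], trivial, hq, by simp [Steps.word]⟩
  | @pop q x a q₁ l x' a' r hΔ hl _ ih =>
    obtain ⟨ℓ, hw, htr, hd⟩ := hΔ
    obtain ⟨s', hs', hrep⟩ := hc.pop l.isLt hl
    obtain ⟨R, hR, hlast, hword⟩ := ih (c := ⟨q₁.1, s', hrep.wellFormed⟩) rfl hrep
    refine ⟨(ℓ, ⟨q₁.1, s', hrep.wellFormed⟩) :: R,
      ⟨⟨x.1, x.2, .pop l, hc.top0_eq, by rw [hq]; exact htr, hs', hd⟩, hR⟩, hlast, ?_⟩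
    rw [hword, hw]
    cases ℓ <;> simp [Steps.word]
  | @push q x a q₁ l y hΔ _ ih =>
    obtain ⟨ℓ, hw, htr, hd⟩ := hΔ
    obtain ⟨s', hs', hrep⟩ := hc.push y l.isLt
    obtain ⟨R, hR, hlast, hword⟩ := ih (c := ⟨q₁.1, s', hrep.wellFormed⟩) rfl hrep
    refine ⟨(ℓ, ⟨q₁.1, s', hrep.wellFormed⟩) :: R,
      ⟨⟨x.1, x.2, .push l y.1, hc.top0_eq, by rw [hq]; exact htr, ?_⟩, hR⟩, hlast, ?_⟩
    · change HStack.push _ (y.1, ℓ.map Prod.snd) _ _ = _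
      rw [← hd]
      exact hs'
    · rw [hword, hw]
      cases ℓ <;> simp [Steps.word]

/-- The zipper `E` can be reached from the initial configuration. -/
def Reachable (M : HOPAD n A Γ Q) (E : Zipper n (Γ × Option D) (Q × List (A × D))) : Prop :=
  Reach (M.wordSystem D) E (M.initState, []) (M.initSymbol, none) fun _ => .nil

theorem accepts_iff {w : List (A × D)} :
    M.Accepts w ↔ ∃ E : Zipper n (Γ × Option D) (Q × List (A × D)),
      E.state.1 ∈ M.accepting ∧ E.state.2 = w ∧ M.Reachable E := by
  constructor
  · rintro ⟨R, hR, rfl, hF⟩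
    obtain ⟨E, hE, h⟩ := reach_of_isRun hR (rep_single n le_rfl _) []
    refine ⟨E, ?_, by rw [hE, List.nil_append], h⟩
    rw [hE]
    exact hF
  · rintro ⟨E, hF, rfl, h⟩
    obtain ⟨R, hR, hlast, hword⟩ :=
      isRun_of_reach h (c := M.init D) rfl (rep_single n le_rfl (M.initSymbol, none))
    exact ⟨R, hR, hword.symm, hlast ▸ hF⟩

theorem Fires.det {q : Q} {x : Γ × Option D} {ℓ ℓ' : Option (A × D)} {q₁ q₁' : Q}
    {op op' : StackOp n (Γ × Option D)} (h : M.Fires q x ℓ q₁ op) (h' : M.Fires q x ℓ' q₁' op') :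
    (ℓ = none ↔ ℓ' = none) ∧ (ℓ = ℓ' → q₁ = q₁' ∧ op = op') := by
  have htr : ∀ {ℓ : Option (A × D)} {q₁ op}, M.Fires q x ℓ q₁ op →
      M.trans q x.1 (ℓ.map Prod.fst) ≠ none := by
    intro ℓ q₁ op h
    cases op <;> rw [h.1] <;> exact Option.some_ne_none _
  refine ⟨⟨?_, ?_⟩, ?_⟩
  · rintro rfl
    cases ℓ' with
    | none => rfl
    | some z => exact absurd (M.deterministic q x.1 z.1 (htr h')) (htr h)
  · rintro rfl
    cases ℓ with
    | none => rfl
    | some z => exact absurd (M.deterministic q x.1 z.1 (htr h)) (htr h')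
  · rintro rfl
    cases op with
    | pop k =>
      cases op' with
      | pop k' =>
        have := h.1.symm.trans h'.1
        simp only [Option.some.injEq, Prod.mk.injEq, StackOp.pop.injEq] at this
        exact ⟨this.1, by rw [this.2]⟩
      | push k' y' => simpa using h.1.symm.trans h'.1
    | push k y =>
      cases op' with
      | pop k' => simpa using h.1.symm.trans h'.1
      | push k' y' =>
        have := h.1.symm.trans h'.1
        simp only [Option.some.injEq, Prod.mk.injEq, StackOp.push.injEq] at this
        exact ⟨this.1, by rw [this.2.1, Prod.ext this.2.2 (h.2.trans h'.2.symm)]⟩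

theorem prefix_antisymm {α : Type*} {v w : List α} (h : v <+: w) (h' : w <+: v) : v = w :=
  h.eq_of_length_le h'.length_le

theorem prefix_of_wordSystem {q q' : Q × List (A × D)} {x : Γ × Option D}
    {op : StackOp n (Γ × Option D)} (h : M.wordSystem D q x q' op) : q.2 <+: q'.2 := by
  obtain ⟨ℓ, h, -⟩ := h
  exact ⟨_, h.symm⟩

theorem _root_.PushdownSystem.Reach.prefix {E : Zipper n (Γ × Option D) (Q × List (A × D))}
    {q : Q × List (A × D)} {x : Γ × Option D} {a : Fin n → Below n (Γ × Option D)}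
    (h : Reach (M.wordSystem D) E q x a) : q.2 <+: E.state.2 := by
  induction h with
  | refl => exact List.prefix_rfl
  | pop hΔ _ _ ih => exact (prefix_of_wordSystem hΔ).trans ih
  | push hΔ _ ih => exact (prefix_of_wordSystem hΔ).trans ih

theorem _root_.PushdownSystem.Ret.prefix {l : Fin n} {q q' : Q × List (A × D)}
    {x : Γ × Option D} {a b : Fin n → Below n (Γ × Option D)}
    (h : Ret (M.wordSystem D) l q x a q' b) : q.2 <+: q'.2 := by
  induction h with
  | last hΔ => exact prefix_of_wordSystem hΔ
  | pop hΔ _ _ _ ih => exact (prefix_of_wordSystem hΔ).trans ih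
  | push hΔ _ _ ih => exact (prefix_of_wordSystem hΔ).trans ih
  | pushRet hΔ _ _ _ ih₁ ih₂ => exact (prefix_of_wordSystem hΔ).trans (ih₁.trans ih₂)

/-- By determinism, of two runs from the same configuration reading a word and a proper extension
of it, the former is an initial part of the latter. -/
theorem reach_of_reach {E F : Zipper n (Γ × Option D) (Q × List (A × D))}
    {q : Q × List (A × D)} {x : Γ × Option D} {a : Fin n → Below n (Γ × Option D)}
    (hE : Reach (M.wordSystem D) E q x a) (hF : Reach (M.wordSystem D) F q x a)
    (hp : E.state.2 <+: F.state.2) (hne : E.state.2 ≠ F.state.2) :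
    Reach (M.wordSystem D) F E.state E.top E.below := by
  have key : ∀ {q₁ q₁' : Q × List (A × D)} {x : Γ × Option D} {q : Q × List (A × D)} {op op'},
      M.wordSystem D q x q₁ op → M.wordSystem D q x q₁' op' → q₁.2 <+: F.state.2 →
      q₁'.2 <+: F.state.2 → q₁ = q₁' ∧ op = op' := by
    rintro ⟨q₁, w₁⟩ ⟨q₁', w₁'⟩ x ⟨q, w⟩ op op' ⟨ℓ, hw, hf⟩ ⟨ℓ', hw', hf'⟩ h h'
    dsimp only at hw hw' hf hf' h h'
    subst hw hw'
    obtain ⟨hnone, hdet⟩ := hf.det hf'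
    have hl : ℓ = ℓ' := by
      cases ℓ with
      | none => exact (hnone.mp rfl).symm
      | some z =>
        cases ℓ' with
        | none => exact absurd (hnone.mpr rfl) (Option.some_ne_none z)
        | some z' =>
          have := List.prefix_of_prefix_length_le h h' (by simp)
          simpa using this
    subst hl
    obtain ⟨rfl, rfl⟩ := hdet rfl
    exact ⟨rfl, rfl⟩
  induction hE with
  | refl => exact hF
  | @pop q x a q₁ l x' a' r hΔ hl h ih =>
    cases hF with
    | refl =>
      exact absurd (prefix_antisymm hp ((prefix_of_wordSystem hΔ).trans h.prefix)) hne
    | pop hΔ' hl' h' =>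
      obtain ⟨rfl, hop⟩ := key hΔ hΔ' (h.prefix.trans hp) h'.prefix
      cases hop
      cases hl.symm.trans hl'
      exact ih h'
    | push hΔ' h' => exact nomatch (key hΔ hΔ' (h.prefix.trans hp) h'.prefix).2
  | @push q x a q₁ l y hΔ h ih =>
    cases hF with
    | refl =>
      exact absurd (prefix_antisymm hp ((prefix_of_wordSystem hΔ).trans h.prefix)) hne
    | pop hΔ' hl' h' => exact nomatch (key hΔ hΔ' (h.prefix.trans hp) h'.prefix).2
    | push hΔ' h' =>
      obtain ⟨rfl, hop⟩ := key hΔ hΔ' (h.prefix.trans hp) h'.prefix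
      cases hop
      exact ih h'

end HOPAD

/-! ### Where the letters are read -/

namespace HOPAD

open PushdownSystem HStack

variable {n : ℕ} {A Γ Q : Type*} {D : Type*} {M : HOPAD n A Γ Q}

/-- The data value `d` is stored in the topmost `K`-stack. -/
abbrev Stores (d : D) (K : ℕ) (x : Γ × Option D) (a : Fin n → Below n (Γ × Option D)) : Prop :=
  TopHas (fun x => x.2 = some d) K x a

/-- The runs in which the topmost `K`-stack of `E` descends from the topmost `K`-stack of the first
zipper, and all letters are read while this stack is topmost. -/
abbrev CleanUp (M : HOPAD n A Γ Q) {D : Type*} (K : ℕ)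
    (E : Zipper n (Γ × Option D) (Q × List (A × D))) :
    Q × List (A × D) → Γ × Option D → (Fin n → Below n (Γ × Option D)) → Prop :=
  Up (M.wordSystem D) (fun q q' => q.2 = q'.2) K E

open Classical in
/-- The number of times the value `d` has been read. -/
noncomputable def timesRead (d : D) (q : Q × List (A × D)) : ℕ := (q.2.map Prod.snd).count d

theorem timesRead_pos {d : D} {q : Q × List (A × D)} :
    0 < timesRead d q ↔ d ∈ q.2.map Prod.snd := by
  classical
  exact List.count_pos_iff

theorem timesRead_le_of_nodup {d : D} {q q' : Q × List (A × D)}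
    (hq : (q.2.map Prod.snd).Nodup) (h : d ∈ q'.2.map Prod.snd) :
    timesRead d q ≤ timesRead d q' := by
  classical
  exact (List.nodup_iff_count_le_one.mp hq d).trans (timesRead_pos.mpr h)

theorem snd_mem_of_push {q q' : Q × List (A × D)} {x y : Γ × Option D} {l : Fin n}
    (h : M.wordSystem D q x q' (.push l y)) {d : D} (hy : y.2 = some d) :
    ∃ z : A × D, z.2 = d ∧ q'.2 = q.2 ++ [z] := by
  obtain ⟨ℓ, hw, -, hℓ⟩ := h
  rw [hy] at hℓ
  cases ℓ with
  | none => cases hℓ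
  | some z => exact ⟨z, (Option.some.inj hℓ).symm, hw⟩

theorem counts_wordSystem (M : HOPAD n A Γ Q) (d : D) :
    Counts (M.wordSystem D) (fun x => x.2 = some d) (timesRead d) := by
  classical
  refine ⟨fun q x q' op h => ?_, fun q x q' l y h hy => ?_⟩
  · exact ((prefix_of_wordSystem h).map Prod.snd).sublist.count_le d
  · obtain ⟨z, rfl, hw⟩ := snd_mem_of_push h hy
    rw [timesRead, timesRead, hw]
    simp

/-- The values stored in the stack have been read. -/
theorem Reachable.mem_of_stores {E : Zipper n (Γ × Option D) (Q × List (A × D))}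
    (hE : M.Reachable E) {d : D} {K : ℕ} (h : Stores d K E.top E.below) :
    d ∈ E.state.2.map Prod.snd := by
  rw [← timesRead_pos]
  by_contra h0
  have hup : Up (M.wordSystem D) (fun _ _ => True) (max K n) E _ _ _ :=
    (Reach.up (ρ := fun _ _ => True) hE).mono (le_max_right K n)
  rcases hup.topHas (counts_wordSystem M d) (h.mono (le_max_left K n)) (by omega) with h | ⟨m, -, h⟩
  · cases h
  · exact h

theorem Reachable.trans {E F : Zipper n (Γ × Option D) (Q × List (A × D))}
    (hE : M.Reachable E) (hF : Reach (M.wordSystem D) F E.state E.top E.below) :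
    M.Reachable F :=
  Reach.trans hE hF

/-- A value read once and still stored in the topmost `(K+1)`-stack of `E` was read when the
ancestor of the topmost `K`-stack of `E` was topmost. -/
theorem Reachable.exists_up {E : Zipper n (Γ × Option D) (Q × List (A × D))}
    (hE : M.Reachable E) (hnd : (E.state.2.map Prod.snd).Nodup) {v u : List (A × D)} {z : A × D}
    (hw : E.state.2 = v ++ z :: u) {K : ℕ} (hz : Stores z.2 (K + 1) E.top E.below) :
    ∃ C : Zipper n (Γ × Option D) (Q × List (A × D)), M.Reachable C ∧ C.state.2 = v ∧
      Up (M.wordSystem D) (fun _ _ => True) K E C.state C.top C.below := by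
  have hzv : z.2 ∉ v.map Prod.snd := fun h => by
    rw [hw, List.map_append, List.map_cons] at hnd
    exact (List.nodup_append.mp hnd).2.2 _ h _ List.mem_cons_self rfl
  have key : ∀ {q x a}, Reach (M.wordSystem D) E q x a → M.Reachable ⟨q, x, a⟩ → q.2 <+: v →
      ∃ C : Zipper n (Γ × Option D) (Q × List (A × D)), M.Reachable C ∧ C.state.2 = v ∧
        Up (M.wordSystem D) (fun _ _ => True) K E C.state C.top C.below := by
    intro q x a h hC hv
    -- a step either stays within `v`, or reads `z`
    have step : ∀ {q q₁ : Q × List (A × D)} {x op}, M.wordSystem D q x q₁ op → q.2 <+: v →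
        q₁.2 <+: E.state.2 → ¬ q₁.2 <+: v → q.2 = v ∧ M.Fires q.1 x (some z) q₁.1 op ∧
          q₁.2 = v ++ [z] := by
      rintro ⟨q, w⟩ ⟨q₁, w₁⟩ x op ⟨ℓ, h₁, hf⟩ hv hE hv₁
      dsimp only at h₁ hf hv hE hv₁ ⊢
      subst h₁
      cases ℓ with
      | none => exact absurd (by simpa using hv) hv₁
      | some y =>
        simp only [Option.toList_some] at hE hv₁ ⊢
        have hlen : v.length < w.length + 1 := by
          by_contra hlen
          exact hv₁ (List.prefix_of_prefix_length_le hE (hw ▸ List.prefix_append v _)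
            (by simpa using Nat.le_of_not_lt hlen))
        obtain rfl : w = v := hv.eq_of_length_le (Nat.lt_succ_iff.mp hlen)
        rw [hw, List.prefix_append_right_inj, List.cons_prefix_cons] at hE
        rw [hE.1] at hf ⊢
        exact ⟨rfl, hf, rfl⟩
    induction h with
    | refl => exact absurd hv.length_le (by simp [hw])
    | @pop q x a q₁ l x' a' r hΔ hl h ih =>
      by_cases hv₁ : q₁.2 <+: v
      · exact ih (hC.trans (.pop hΔ hl .refl)) hv₁
      · obtain ⟨rfl, ⟨-, hf⟩, -⟩ := step hΔ hv h.prefix hv₁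
        exact absurd (hC.mem_of_stores (K := 0) (d := z.2)
          (Or.inl (hf.resolve_left (Option.some_ne_none _)).symm)) hzv
    | @push q x a q₁ l y hΔ h ih =>
      by_cases hv₁ : q₁.2 <+: v
      · exact ih (hC.trans (.push hΔ .refl)) hv₁
      · obtain ⟨rfl, -, hq₁⟩ := step hΔ hv h.prefix hv₁
        have hno : ∀ K, ¬ Stores z.2 K x a := fun K hx => hzv (hC.mem_of_stores hx)
        refine ⟨⟨q, x, a⟩, hC, rfl, .push hΔ (h.up_of_topHas (counts_wordSystem M z.2)
          (timesRead_le_of_nodup hnd (by simp [hq₁])) (fun m hm => ?_) hz)⟩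
        rcases hm.of_dup with hm | ⟨hm, -⟩
        · exact hno n (Or.inr ⟨m, m.isLt, hm⟩)
        · exact hno _ hm
  exact key hE .refl List.nil_prefix

/-- If all values read are distinct and still stored in the topmost `(K+1)`-stack at the end, then
no letter is read while the ancestor of the topmost `K`-stack is not topmost. -/
theorem Reachable.cleanUp {K : ℕ} {E : Zipper n (Γ × Option D) (Q × List (A × D))}
    (hnd : (E.state.2.map Prod.snd).Nodup) {q : Q × List (A × D)} {x : Γ × Option D}
    {a : Fin n → Below n (Γ × Option D)} (hC : M.Reachable ⟨q, x, a⟩)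
    (h : Up (M.wordSystem D) (fun _ _ => True) K E q x a)
    (hE : ∀ v, E.state.2 = q.2 ++ v → ∀ z ∈ v, Stores z.2 (K + 1) E.top E.below) :
    M.CleanUp K E q x a := by
  have mono : ∀ {q q₁ : Q × List (A × D)}, q.2 <+: q₁.2 →
      (∀ v, E.state.2 = q.2 ++ v → ∀ z ∈ v, Stores z.2 (K + 1) E.top E.below) →
      ∀ v, E.state.2 = q₁.2 ++ v → ∀ z ∈ v, Stores z.2 (K + 1) E.top E.below := by
    rintro q q₁ ⟨t, ht⟩ hE v hv z hz
    exact hE (t ++ v) (by rw [hv, ← ht, List.append_assoc]) z (List.mem_append_right t hz)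
  induction h with
  | refl => exact .refl
  | pop hΔ hK hl _ ih =>
    exact .pop hΔ hK hl (ih (hC.trans (.pop hΔ hl .refl)) (mono (prefix_of_wordSystem hΔ) hE))
  | push hΔ _ ih =>
    exact .push hΔ (ih (hC.trans (.push hΔ .refl)) (mono (prefix_of_wordSystem hΔ) hE))
  | @pushRet q x a q₁ l y q₂ c hΔ hK _ h₁ h₂ ih =>
    have hp : q.2 <+: q₂.2 := (prefix_of_wordSystem hΔ).trans h₁.prefix
    have hC₂ : M.Reachable ⟨q₂, x, splice l a c⟩ := hC.trans
      (.push hΔ (h₁.reach (dup_self _ _ _) (by rw [join_trunc]; exact .refl)))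
    refine .pushRet hΔ hK ?_ h₁ (ih hC₂ (mono hp hE))
    -- a letter read during the excursion would be lost from the topmost `(K+1)`-stack
    obtain ⟨v, hv⟩ := hp
    obtain ⟨u, hu⟩ := h₂.reach.prefix
    cases v with
    | nil => simpa using hv
    | cons z v =>
      exfalso
      have hz := hE (z :: v ++ u) (by rw [← hu, ← hv, List.append_assoc]) z (by simp)
      have hz₂ := (h₂.mono (Nat.le_succ K)).topHas (counts_wordSystem M z.2) hz
        (timesRead_le_of_nodup hnd (by simp [← hv]))
      have hzq := hC.mem_of_stores (hz₂.congr fun m hm =>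
        splice_of_le (show m.val ≤ l.val by omega) a c)
      rw [← hu, ← hv, List.map_append, List.map_append] at hnd
      exact (List.nodup_append.mp (List.nodup_append.mp hnd).1).2.2 _ hzq z.2 (by simp) rfl

/-- Since nothing is read during the excursions, the ancestor of the topmost `K`-stack is topmost at
some moment after reading any given part of the word. -/
theorem CleanUp.split {K : ℕ} {E : Zipper n (Γ × Option D) (Q × List (A × D))}
    {q : Q × List (A × D)} {x : Γ × Option D} {a : Fin n → Below n (Γ × Option D)}
    (h : M.CleanUp K E q x a) {v : List (A × D)} (hv : q.2 <+: v) (hvE : v <+: E.state.2) :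
    ∃ C : Zipper n (Γ × Option D) (Q × List (A × D)), C.state.2 = v ∧
      M.CleanUp K C q x a ∧ M.CleanUp K E C.state C.top C.below := by
  have step : ∀ {q q₁ : Q × List (A × D)} {x op}, M.wordSystem D q x q₁ op → q.2 <+: v →
      q₁.2 <+: E.state.2 → q.2 ≠ v → q₁.2 <+: v := by
    rintro ⟨q, w⟩ ⟨q₁, w₁⟩ x op ⟨ℓ, h₁, -⟩ hv hE hne
    dsimp only at h₁ hv hE hne ⊢
    subst h₁
    refine List.prefix_of_prefix_length_le hE hvE ?_
    have : w.length < v.length := lt_of_not_ge fun h => hne (hv.eq_of_length_le h)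
    cases ℓ <;> simp <;> omega
  induction h with
  | refl => exact ⟨E, prefix_antisymm hv hvE, .refl, .refl⟩
  | @pop q x a q₁ l x' a' r hΔ hK hl h ih =>
    by_cases hq : q.2 = v
    · exact ⟨⟨q, x, a⟩, hq, .refl, .pop hΔ hK hl h⟩
    · obtain ⟨C, hCv, hC, hCE⟩ := ih (step hΔ hv h.reach.prefix hq)
      exact ⟨C, hCv, .pop hΔ hK hl hC, hCE⟩
  | @push q x a q₁ l y hΔ h ih =>
    by_cases hq : q.2 = v
    · exact ⟨⟨q, x, a⟩, hq, .refl, .push hΔ h⟩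
    · obtain ⟨C, hCv, hC, hCE⟩ := ih (step hΔ hv h.reach.prefix hq)
      exact ⟨C, hCv, .push hΔ hC, hCE⟩
  | @pushRet q x a q₁ l y q₂ c hΔ hK hρ h₁ h₂ ih =>
    by_cases hq : q.2 = v
    · exact ⟨⟨q, x, a⟩, hq, .refl, .pushRet hΔ hK hρ h₁ h₂⟩
    · obtain ⟨C, hCv, hC, hCE⟩ := ih (by rwa [← hρ])
      exact ⟨C, hCv, .pushRet hΔ hK hρ h₁ hC, hCE⟩

/-! ### Searching for a data value after the dollar -/

/-- Whether the dollar has been read, and then the value searched for. -/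
inductive Phase
  | before : Phase
  | after : Phase
  | found : Phase

instance : Finite Phase :=
  Finite.of_surjective
    (fun i : Fin 3 => (![Phase.before, Phase.after, Phase.found] : Fin 3 → Phase) i)
    fun x => by cases x <;> [exact ⟨0, rfl⟩; exact ⟨1, rfl⟩; exact ⟨2, rfl⟩]

/-- The change of phase when a label is read.  The value searched for need not be noticed; in the
phase `before` no other letter than the dollar is allowed. -/
def Phase.Moves (d : D) : Phase → Option (Letter × D) → Phase → Prop
  | p, none, p' => p' = p
  | before, some z, p' => z.1 = Letter.dollar ∧ p' = after
  | after, some z, p' => p' = after ∨ z.2 = d ∧ p' = found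
  | found, some _, p' => p' = found

/-- The words which lead from a given phase to the phase `found`. -/
def Phase.Completes (d : D) : Phase → List (Letter × D) → Prop
  | before, w => ∃ e y, w = (Letter.dollar, e) :: y ∧ d ∈ y.map Prod.snd
  | after, w => d ∈ w.map Prod.snd
  | found, _ => True

theorem Phase.completes_append {d : D} {p : Phase} {ℓ : Option (Letter × D)}
    {w : List (Letter × D)} :
    p.Completes d (ℓ.toList ++ w) ↔ ∃ p', p.Moves d ℓ p' ∧ p'.Completes d w := by
  cases ℓ with
  | none => simp [Phase.Moves]
  | some z =>
    obtain ⟨b, e⟩ := z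
    cases p with
    | before =>
      simp only [Completes, Option.toList_some, List.singleton_append, List.cons.injEq,
        Prod.mk.injEq, Moves]
      constructor
      · rintro ⟨e, y, ⟨⟨rfl, rfl⟩, rfl⟩, h⟩
        exact ⟨after, ⟨rfl, rfl⟩, h⟩
      · rintro ⟨p', ⟨rfl, rfl⟩, h⟩
        exact ⟨e, w, ⟨⟨rfl, rfl⟩, rfl⟩, h⟩
    | after =>
      simp only [Completes, Option.toList_some, List.singleton_append, List.map_cons,
        List.mem_cons, Moves]
      constructor
      · rintro (rfl | h)
        · exact ⟨found, Or.inr ⟨rfl, rfl⟩, trivial⟩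
        · exact ⟨after, Or.inl rfl, h⟩
      · rintro ⟨p', rfl | ⟨rfl, rfl⟩, h⟩
        · exact Or.inr h
        · exact Or.inl rfl
    | found =>
      simp [Completes, Moves]

variable {M : HOPAD n Letter Γ Q}

/-- The automaton as a pushdown system which searches for the value `d` after the dollar. -/
def searchSystem (M : HOPAD n Letter Γ Q) (d : D) :
    PushdownSystem n (Γ × Option D) (Q × Phase) :=
  fun q x q' op => ∃ ℓ : Option (Letter × D), q.2.Moves d ℓ q'.2 ∧ M.Fires q.1 x ℓ q'.1 op

/-- The states in which the automaton accepts and the search has been successful. -/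
def searchFinal (M : HOPAD n Letter Γ Q) : Set (Q × Phase) :=
  {q | q.1 ∈ M.accepting ∧ q.2 = .found}

theorem reach_searchSystem {d : D} {E : Zipper n (Γ × Option D) (Q × List (Letter × D))}
    (hE : E.state.1 ∈ M.accepting) {q : Q × List (Letter × D)} {x : Γ × Option D}
    {a : Fin n → Below n (Γ × Option D)} (h : Reach (M.wordSystem D) E q x a) {p : Phase}
    {z : List (Letter × D)} (hz : E.state.2 = q.2 ++ z) (hp : p.Completes d z) :
    ∃ E' : Zipper n (Γ × Option D) (Q × Phase), E'.state ∈ M.searchFinal ∧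
      Reach (M.searchSystem d) E' (q.1, p) x a := by
  have step : ∀ {q q₁ : Q × List (Letter × D)} {x op} {p : Phase} {z : List (Letter × D)},
      M.wordSystem D q x q₁ op → q₁.2 <+: E.state.2 → E.state.2 = q.2 ++ z → p.Completes d z →
      ∃ p₁ z₁, M.searchSystem d (q.1, p) x (q₁.1, p₁) op ∧ E.state.2 = q₁.2 ++ z₁ ∧
        p₁.Completes d z₁ := by
    rintro q q₁ x op p z ⟨ℓ, hw, hf⟩ ⟨z₁, hz₁⟩ hz hp
    have : z = ℓ.toList ++ z₁ := by
      rw [← hz₁, hw, List.append_assoc] at hz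
      exact (List.append_cancel_left hz).symm
    rw [this, Phase.completes_append] at hp
    obtain ⟨p₁, hm, hp₁⟩ := hp
    exact ⟨p₁, z₁, ⟨ℓ, hm, hf⟩, hz₁.symm, hp₁⟩
  induction h generalizing p z with
  | refl =>
    obtain rfl : z = [] := by simpa using hz
    cases p with
    | before => obtain ⟨e, y, h, -⟩ := hp; cases h
    | after => cases hp
    | found => exact ⟨⟨(E.state.1, .found), E.top, E.below⟩, ⟨hE, rfl⟩, .refl⟩
  | pop hΔ hl h ih =>
    obtain ⟨p₁, z₁, hΔ₁, hz₁, hp₁⟩ := step hΔ h.prefix hz hp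
    obtain ⟨E', hE', h'⟩ := ih hz₁ hp₁
    exact ⟨E', hE', .pop hΔ₁ hl h'⟩
  | push hΔ h ih =>
    obtain ⟨p₁, z₁, hΔ₁, hz₁, hp₁⟩ := step hΔ h.prefix hz hp
    obtain ⟨E', hE', h'⟩ := ih hz₁ hp₁
    exact ⟨E', hE', .push hΔ₁ h'⟩

theorem reach_wordSystem {d : D} {E : Zipper n (Γ × Option D) (Q × Phase)}
    (hE : E.state ∈ M.searchFinal) {q : Q × Phase} {x : Γ × Option D}
    {a : Fin n → Below n (Γ × Option D)} (h : Reach (M.searchSystem d) E q x a)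
    (w : List (Letter × D)) :
    ∃ E' : Zipper n (Γ × Option D) (Q × List (Letter × D)), E'.state.1 ∈ M.accepting ∧
      (∃ z, E'.state.2 = w ++ z ∧ q.2.Completes d z) ∧
      Reach (M.wordSystem D) E' (q.1, w) x a := by
  induction h generalizing w with
  | refl => exact ⟨⟨(E.state.1, w), E.top, E.below⟩, hE.1, ⟨[], by simp, by
      rw [hE.2]; trivial⟩, .refl⟩
  | pop hΔ hl _ ih =>
    obtain ⟨ℓ, hm, hf⟩ := hΔ
    obtain ⟨E', hE', ⟨z, hz, hp⟩, h'⟩ := ih (w ++ ℓ.toList)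
    exact ⟨E', hE', ⟨ℓ.toList ++ z, by rw [hz, List.append_assoc],
      Phase.completes_append.mpr ⟨_, hm, hp⟩⟩, .pop ⟨ℓ, rfl, hf⟩ hl h'⟩
  | push hΔ _ ih =>
    obtain ⟨ℓ, hm, hf⟩ := hΔ
    obtain ⟨E', hE', ⟨z, hz, hp⟩, h'⟩ := ih (w ++ ℓ.toList)
    exact ⟨E', hE', ⟨ℓ.toList ++ z, by rw [hz, List.append_assoc],
      Phase.completes_append.mpr ⟨_, hm, hp⟩⟩, .push ⟨ℓ, rfl, hf⟩ h'⟩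

theorem ret_searchSystem {d : D} {l : Fin n} {q q' : Q × List (Letter × D)} {x : Γ × Option D}
    {a b : Fin n → Below n (Γ × Option D)} (h : Ret (M.wordSystem D) l q x a q' b)
    (hq : q'.2 <+: q.2) : Ret (M.searchSystem d) l (q.1, .before) x a (q'.1, .before) b := by
  have step : ∀ {q q₁ : Q × List (Letter × D)} {x op}, M.wordSystem D q x q₁ op →
      q₁.2 <+: q.2 → M.searchSystem d (q.1, .before) x (q₁.1, .before) op := by
    rintro q q₁ x op ⟨ℓ, hw, hf⟩ hp
    cases ℓ with
    | none => exact ⟨none, rfl, hf⟩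
    | some z => exact absurd hp.length_le (by simp [hw])
  induction h with
  | last hΔ => exact .last (step hΔ hq)
  | pop hΔ hk hl h ih =>
    exact .pop (step hΔ (h.prefix.trans hq)) hk hl (ih (hq.trans (prefix_of_wordSystem hΔ)))
  | push hΔ hk h ih =>
    exact .push (step hΔ (h.prefix.trans hq)) hk (ih (hq.trans (prefix_of_wordSystem hΔ)))
  | pushRet hΔ hk h₁ h₂ ih₁ ih₂ =>
    exact .pushRet (step hΔ ((h₁.prefix.trans h₂.prefix).trans hq)) hk
      (ih₁ ((h₂.prefix.trans hq).trans (prefix_of_wordSystem hΔ)))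
      (ih₂ (hq.trans ((prefix_of_wordSystem hΔ).trans h₁.prefix)))

theorem ret_wordSystem {d : D} {l : Fin n} {q q' : Q × Phase} {x : Γ × Option D}
    {a b : Fin n → Below n (Γ × Option D)} (h : Ret (M.searchSystem d) l q x a q' b)
    (hq' : q'.2 = .before) (w : List (Letter × D)) :
    q.2 = .before ∧ Ret (M.wordSystem D) l (q.1, w) x a (q'.1, w) b := by
  have step : ∀ {q q₁ : Q × Phase} {x op}, M.searchSystem d q x q₁ op → q₁.2 = .before →
      q.2 = .before ∧ M.wordSystem D (q.1, w) x (q₁.1, w) op := by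
    rintro ⟨q, p⟩ ⟨q₁, p₁⟩ x op ⟨ℓ, hm, hf⟩ rfl
    cases ℓ with
    | none => exact ⟨hm.symm, none, by simp, hf⟩
    | some z => cases p <;> simp [Phase.Moves] at hm
  induction h with
  | last hΔ => exact ⟨(step hΔ hq').1, .last (step hΔ hq').2⟩
  | pop hΔ hk hl _ ih =>
    have := step hΔ (ih hq').1
    exact ⟨this.1, .pop this.2 hk hl (ih hq').2⟩
  | push hΔ hk _ ih =>
    have := step hΔ (ih hq').1
    exact ⟨this.1, .push this.2 hk (ih hq').2⟩
  | pushRet hΔ hk _ _ ih₁ ih₂ =>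
    have h₁ := ih₁ (ih₂ hq').1
    have := step hΔ h₁.1
    exact ⟨this.1, .pushRet this.2 hk h₁.2 (ih₂ hq').2⟩

open Classical in
/-- Exchange two data values. -/
noncomputable def exchange (d d' : D) (x : Γ × Option D) : Γ × Option D :=
  (x.1, x.2.map (Equiv.swap d d'))

theorem exchange_comm (d d' : D) : (exchange d d' : Γ × Option D → _) = exchange d' d := by
  classical
  funext x
  rw [exchange, exchange, Equiv.swap_comm]

theorem eq_of_exchange_ne {d d' : D} {x : Γ × Option D} (h : exchange d d' x ≠ x) :
    x.2 = some d ∨ x.2 = some d' := by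
  classical
  by_contra! hx
  apply h
  obtain ⟨γ, e⟩ := x
  cases e with
  | none => rfl
  | some e =>
    simp only [ne_eq, Option.some.injEq] at hx
    simp [exchange, Equiv.swap_apply_of_ne_of_ne hx.1 hx.2]

theorem transports_exchange (M : HOPAD n Letter Γ Q) (d d' : D) :
    Transports M.searchSystem (exchange d d') d d' := by
  classical
  have hm : ∀ {p p' : Phase} {ℓ : Option (Letter × D)}, p.Moves d ℓ p' →
      p.Moves d' (ℓ.map fun z => (z.1, Equiv.swap d d' z.2)) p' := by
    intro p p' ℓ h
    cases ℓ with
    | none => exact h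
    | some z =>
      cases p with
      | before => exact h
      | after => exact h.imp_right (And.imp_left fun h => by simp [h])
      | found => exact h
  have hfst : ∀ ℓ : Option (Letter × D),
      (ℓ.map fun z => (z.1, Equiv.swap d d' z.2)).map Prod.fst = ℓ.map Prod.fst := by
    intro ℓ
    cases ℓ <;> rfl
  have hsnd : ∀ ℓ : Option (Letter × D),
      (ℓ.map fun z => (z.1, Equiv.swap d d' z.2)).map Prod.snd =
        (ℓ.map Prod.snd).map (Equiv.swap d d') := by
    intro ℓ
    cases ℓ <;> rfl
  refine ⟨?_, ?_⟩
  · rintro q x q' l ⟨ℓ, h, htr, hd⟩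
    refine ⟨_, hm h, by rw [hfst]; exact htr, ?_⟩
    rw [hsnd]
    exact hd.imp (fun h => by rw [h]; rfl) fun h => by rw [h]; rfl
  · rintro q x q' l y ⟨ℓ, h, htr, hd⟩
    refine ⟨_, hm h, by rw [hfst]; exact htr, ?_⟩
    rw [hsnd, ← hd]
    rfl

/-- Stacks known to store neither `d` nor `d'` may be kept when passing from the search for `d` to
the search for `d'`. -/
theorem dominates_of_topHas {d d' : D} {K : ℕ} {x : Γ × Option D}
    {a a' : Fin n → Below n (Γ × Option D)}
    (hx : ¬ TopHas (fun x => exchange d d' x ≠ x) K x a)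
    (hlow : ∀ m : Fin n, m.val < K → a' m = a m)
    (hhigh : ∀ m : Fin n, K ≤ m.val →
      (d', a' m) ∈ stackType M.searchSystem M.searchFinal d m (a m)) :
    Dominates M.searchSystem M.searchFinal d d' a a' := by
  intro m
  rcases lt_or_ge m.val K with hm | hm
  · rw [hlow m hm, stackType_eq_of_fixed (transports_exchange M d d')
      (exchange_comm d d' ▸ transports_exchange M d' d) fun h => hx (Or.inr ⟨m, hm, h⟩)]
    exact mem_stackType d' m (a m)
  · exact hhigh m hm

/-- Let a run be such that all its letters are read while the ancestor of the topmost `K`-stack of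
`C` is topmost, and that this ancestor stores neither `d` nor `d'`.  If from `C` some word is
accepted in which `d` occurs after an initial dollar, and the surrounding stacks are replaced by
stacks satisfying, when searching for `d'`, the types which the original ones have when searching
for `d`, then the word read by the run can still be read, and afterwards a word in which `d'` occurs
after an initial dollar can be accepted. -/
theorem CleanUp.transfer {d d' : D} {K : ℕ} {C : Zipper n (Γ × Option D) (Q × List (Letter × D))}
    {G : Zipper n (Γ × Option D) (Q × List (Letter × D))}
    (hG : Reach (M.wordSystem D) G C.state C.top C.below) (hacc : G.state.1 ∈ M.accepting)
    {z : List (Letter × D)} (hz : G.state.2 = C.state.2 ++ z)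
    (hd : Phase.before.Completes d z)
    {q : Q × List (Letter × D)} {x : Γ × Option D} {a : Fin n → Below n (Γ × Option D)}
    (h : M.CleanUp K C q x a) {v : List (Letter × D)} (hv : C.state.2 = q.2 ++ v)
    (hvd : ∀ y ∈ v, y.2 ≠ d ∧ y.2 ≠ d')
    (hx : ¬ TopHas (fun x => exchange d d' x ≠ x) K x a)
    {a' : Fin n → Below n (Γ × Option D)} (hlow : ∀ m : Fin n, m.val < K → a' m = a m)
    (hhigh : ∀ m : Fin n, K ≤ m.val →
      (d', a' m) ∈ stackType M.searchSystem M.searchFinal d m (a m)) :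
    ∃ G' : Zipper n (Γ × Option D) (Q × List (Letter × D)), G'.state.1 ∈ M.accepting ∧
      (∃ z', G'.state.2 = C.state.2 ++ z' ∧ Phase.before.Completes d' z') ∧
      Reach (M.wordSystem D) G' q x a' := by
  have hθ := transports_exchange M d d'
  have split : ∀ {q q₁ : Q × List (Letter × D)} {x op} {v : List (Letter × D)},
      M.wordSystem D q x q₁ op → q₁.2 <+: C.state.2 → C.state.2 = q.2 ++ v →
      (∀ y ∈ v, y.2 ≠ d ∧ y.2 ≠ d') → ∃ v₁, C.state.2 = q₁.2 ++ v₁ ∧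
        (∀ y ∈ v₁, y.2 ≠ d ∧ y.2 ≠ d') ∧ ∀ l y, op = .push l y → exchange d d' y = y := by
    rintro q q₁ x op v ⟨ℓ, hw, hf⟩ ⟨v₁, hv₁⟩ hv hvd
    have hvv : v = ℓ.toList ++ v₁ := by
      rw [← hv₁, hw, List.append_assoc] at hv
      exact (List.append_cancel_left hv).symm
    refine ⟨v₁, hv₁.symm, fun y hy => hvd y (by simp [hvv, hy]), ?_⟩
    rintro l y rfl
    by_contra hy
    obtain ⟨-, hf⟩ := hf
    rcases eq_of_exchange_ne hy with h | h
    all_goals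
      rw [h] at hf
      cases ℓ with
      | none => cases hf
      | some s =>
        have := hvd s (by simp [hvv])
        simp only [Option.map_some, Option.some.injEq] at hf
        simp [← hf] at this
  induction h generalizing a' v with
  | refl =>
    obtain ⟨E, hE, h⟩ := reach_searchSystem hacc hG hz hd
    obtain ⟨E', hE', h'⟩ := (dominates_of_topHas hx hlow hhigh).reach hθ
      (not_not.mp fun h => hx (Or.inl h)) hE h
    exact reach_wordSystem hE' h' C.state.2
  | @pop q x a q₁ l x' a₁ r hΔ hK hl h ih =>
    obtain ⟨v₁, hv₁, hvd₁, -⟩ := split hΔ h.reach.prefix hv hvd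
    obtain ⟨G', hG', hz', h'⟩ := ih (a' := join l a₁ r a') hv₁ hvd₁ (fun h => hx (.of_pop hK hl h))
      (fun m hm => by
        by_cases hml : l < m
        · rw [join_of_gt hml, join_of_gt hml, hlow m hm]
        · simp only [join]
          split_ifs
          · rfl
          · rfl
          · exact absurd (lt_of_le_of_ne (not_lt.mp ‹_›) (Ne.symm ‹_›)) hml)
      fun m hm => by
        have hml : l < m := Fin.lt_def.mpr (hK.trans_le hm)
        rw [join_of_gt hml, join_of_gt hml]
        exact hhigh m hm
    exact ⟨G', hG', hz', .pop hΔ ((hlow l hK).trans hl) h'⟩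
  | @push q x a q₁ l y hΔ h ih =>
    obtain ⟨v₁, hv₁, hvd₁, hy⟩ := split hΔ h.reach.prefix hv hvd
    have hdom := (dominates_of_topHas hx hlow hhigh).dup hθ (not_not.mp fun h => hx (Or.inl h)) l
    obtain ⟨G', hG', hz', h'⟩ := ih (a' := dup l x a') hv₁ hvd₁
      (fun h => hx (h.of_dup (not_not.mpr (hy l y rfl))))
      (fun m hm => by
        by_cases hml : m = l
        · subst hml
          rw [dup_self, dup_self, hlow m hm]
          congr 1
          funext k
          by_cases hk : k < m
          · rw [trunc_of_lt hk, trunc_of_lt hk, hlow k (lt_trans hk hm)]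
          · simp [trunc, hk]
        · rw [dup_of_ne hml, dup_of_ne hml, hlow m hm])
      fun m _ => hdom m
    exact ⟨G', hG', hz', .push hΔ h'⟩
  | @pushRet q x a q₁ l y q₂ c hΔ hK hρ h₁ h₂ ih =>
    have hxx : exchange d d' x = x := not_not.mp fun h => hx (Or.inl h)
    have hdom := dominates_of_topHas hx hlow hhigh
    obtain ⟨v₁, hv₁, hvd₁, hy⟩ := split hΔ (h₁.prefix.trans h₂.reach.prefix) hv hvd
    have hq₁ : q₁.2 = q.2 :=
      prefix_antisymm (hρ ▸ h₁.prefix) (prefix_of_wordSystem hΔ)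
    obtain ⟨c', hc', hdom'⟩ := (hdom.dup hθ hxx l).ret hθ (hy l y rfl)
      (ret_searchSystem (d := d) h₁ (by rw [hq₁, hρ]))
    have hret := (ret_wordSystem hc' rfl q.2).2
    rw [show (q₁.1, q.2) = q₁ from Prod.ext rfl hq₁.symm,
      show (q₂.1, q.2) = q₂ from Prod.ext rfl hρ] at hret
    obtain ⟨G', hG', hz', h'⟩ := ih (a' := splice l a' c') (v := v) (by rw [← hρ, hv]) hvd
      (fun h => hx (h.congr fun m hm => splice_of_le (show m.val ≤ l.val from hm.le.trans hK) a c))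
      (fun m hm => by
        have hml : m ≤ l := Fin.le_def.mpr (hm.le.trans hK)
        rw [splice_of_le hml, splice_of_le hml, hlow m hm])
      fun m hm => by
        rcases le_or_gt m l with hml | hml
        · rw [splice_of_le hml, splice_of_le hml]
          exact hhigh m hm
        · rw [splice_of_gt hml, splice_of_gt hml]
          exact hdom' m hml
    refine ⟨G', hG', hz', .push hΔ (hret.reach (dup_self _ _ _) ?_)⟩
    rwa [join_trunc]

end HOPAD

/-! ### Bracket words and the language `U` -/

theorem bracketHeight_append (u v : List Letter) :
    bracketHeight (u ++ v) = bracketHeight u + bracketHeight v := by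
  induction u with
  | nil => simp [bracketHeight]
  | cons x u ih => cases x <;> simp only [List.cons_append, bracketHeight, ih] <;> ring

theorem bracketHeight_reverse (u : List Letter) : bracketHeight u.reverse = bracketHeight u := by
  induction u with
  | nil => rfl
  | cons x u ih =>
    rw [List.reverse_cons, bracketHeight_append, ih]
    cases x <;> simp [bracketHeight]; ring

/-- No closing bracket is unmatched. -/
def NonnegHeights (w : List Letter) : Prop := ∀ v : List Letter, v <+: w → 0 ≤ bracketHeight v

theorem NonnegHeights.append {u v : List Letter} (hu : NonnegHeights u)
    (hv : ∀ t, t <+: v → 0 ≤ bracketHeight u + bracketHeight t) : NonnegHeights (u ++ v) := by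
  rintro t ⟨s, hs⟩
  rcases List.append_eq_append_iff.mp hs with ⟨r, rfl, -⟩ | ⟨r, rfl, rfl⟩
  · exact hu t (List.prefix_append t r)
  · rw [bracketHeight_append]
    exact hv r (List.prefix_append r s)

theorem IsBracketExpr.append {u v : List Letter} (hu : IsBracketExpr u) (hv : IsBracketExpr v) :
    IsBracketExpr (u ++ v) := by
  refine ⟨by simp [hu.1, hv.1], NonnegHeights.append hu.2.1 fun t ht => ?_, ?_⟩
  · rw [hu.2.2, zero_add]
    exact hv.2.1 t ht
  · rw [bracketHeight_append, hu.2.2, hv.2.2, zero_add]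

theorem IsBracketExpr.bracket {u : List Letter} (hu : IsBracketExpr u) :
    IsBracketExpr ([Letter.opening] ++ (u ++ [Letter.closing])) := by
  have h1 : ∀ t, t <+: u → 0 ≤ bracketHeight [Letter.opening] + bracketHeight t := fun t ht =>
    add_nonneg (by simp [bracketHeight]) (hu.2.1 t ht)
  refine ⟨by simp [hu.1], NonnegHeights.append (fun t ht => ?_) fun t ht => ?_, ?_⟩
  · rcases List.prefix_concat_iff.mp (show t <+: [] ++ [Letter.opening] from ht) with rfl | ht
    · simp [bracketHeight]
    · rw [List.prefix_nil.mp ht]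
      simp [bracketHeight]
  · rcases List.prefix_concat_iff.mp ht with rfl | ht
    · simp [bracketHeight_append, hu.2.2, bracketHeight]
    · exact h1 t ht
  · simp [bracketHeight_append, hu.2.2, bracketHeight]

/-- The word `(b [)^r ]^r`. -/
def nest (b : List Letter) (r : ℕ) : List Letter :=
  (List.replicate r (b ++ [Letter.opening])).flatten ++ List.replicate r Letter.closing

theorem isBracketExpr_nest {b : List Letter} (hb : IsBracketExpr b) (r : ℕ) :
    IsBracketExpr (nest b r) := by
  induction r with
  | zero => exact ⟨by simp [nest], fun v hv => by
      rw [List.prefix_nil.mp hv, bracketHeight], rfl⟩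
  | succ r ih =>
    have : nest b (r + 1) = b ++ ([Letter.opening] ++ (nest b r ++ [Letter.closing])) := by
      rw [nest, nest, List.replicate_succ, List.flatten_cons, List.replicate_succ']
      simp only [List.append_assoc]
    rw [this]
    exact hb.append ih.bracket

/-- The words `b_0 = [ ]` and `b_{k+1} = (b_k [)^N ]^N`; thus `b_k [` is the word `w_k`. -/
def blockWord (N : ℕ) : ℕ → List Letter
  | 0 => [Letter.opening, Letter.closing]
  | k + 1 => nest (blockWord N k) N

theorem isBracketExpr_blockWord (N k : ℕ) : IsBracketExpr (blockWord N k) := by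
  induction k with
  | zero => exact IsBracketExpr.bracket (u := []) ⟨by simp, fun v hv => by
      rw [List.prefix_nil.mp hv, bracketHeight], rfl⟩
  | succ k ih => exact isBracketExpr_nest ih N

/-- Exchange opening and closing brackets. -/
def Letter.flip : Letter → Letter
  | opening => closing
  | closing => opening
  | dollar => dollar

theorem bracketHeight_map_flip (u : List Letter) :
    bracketHeight (u.map Letter.flip) = -bracketHeight u := by
  induction u with
  | nil => rfl
  | cons x u ih => cases x <;> simp [Letter.flip, bracketHeight, ih] <;> ring

/-- The only word symmetric to `q`. -/
def mirror {D : Type*} (q : List (Letter × D)) : List (Letter × D) :=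
  (q.map fun z => (z.1.flip, z.2)).reverse

theorem mem_snd_mirror {D : Type*} {q : List (Letter × D)} {d : D} :
    d ∈ (mirror q).map Prod.snd ↔ d ∈ q.map Prod.snd := by
  simp [mirror]

theorem isBracketExpr_mirror {D : Type*} {q m : List (Letter × D)}
    (hq : Letter.dollar ∉ letters q) (hq' : NonnegHeights (letters q))
    (hm : IsBracketExpr (letters m)) : IsBracketExpr (letters (q ++ m ++ mirror q)) := by
  have hmir : letters (mirror q) = ((letters q).map Letter.flip).reverse := by
    simp [letters, mirror, Function.comp_def]
  have happ : letters (q ++ m ++ mirror q) = letters q ++ letters m ++ letters (mirror q) := by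
    simp [letters]
  rw [happ, hmir]
  generalize letters q = u at hq hq'
  generalize letters m = v at hm
  have hflip : Letter.dollar ∉ u.map Letter.flip := fun h => by
    obtain ⟨x, hx, h⟩ := List.mem_map.mp h
    cases x <;> first | exact hq hx | cases h
  refine ⟨by simpa [hq, hm.1] using hflip,
    NonnegHeights.append (NonnegHeights.append hq' ?_) ?_, ?_⟩
  · exact fun t ht => add_nonneg (hq' _ List.prefix_rfl) (hm.2.1 t ht)
  · rintro t ⟨s, hs⟩
    -- the closed part of `u` is matched by `t`, and a prefix of `u` remains
    have hs' : u.map Letter.flip = s.reverse ++ t.reverse := by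
      rw [← List.reverse_append, hs, List.reverse_reverse]
    obtain ⟨u₁, u₂, rfl, -, h₂⟩ := List.map_eq_append_iff.mp hs'
    rw [bracketHeight_append, hm.2.2, ← bracketHeight_reverse t, ← h₂, bracketHeight_map_flip,
      bracketHeight_append]
    have := hq' u₁ (List.prefix_append _ _)
    linarith
  · rw [bracketHeight_append, bracketHeight_append, hm.2.2, bracketHeight_reverse,
      bracketHeight_map_flip]
    ring

theorem mem_langU {D : Type*} {q m : List (Letter × D)} (d : D)
    (hq : Letter.dollar ∉ letters q) (hq' : NonnegHeights (letters q))
    (hm : IsBracketExpr (letters m))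
    (hlast : q = [] ∨ ∃ q' e, q = q' ++ [(Letter.opening, e)]) :
    q ++ m ++ (Letter.dollar, d) :: mirror q ∈ langU D := by
  refine ⟨q, m, mirror q, d, rfl, isBracketExpr_mirror hq hq' hm, hm, hlast, ?_⟩
  rw [mirror, List.reverse_reverse, List.forall₂_map_right_iff, List.forall₂_same]
  rintro ⟨x, e⟩ hx
  refine ⟨rfl, ?_⟩
  cases x with
  | opening => exact Or.inl ⟨rfl, rfl⟩
  | closing => exact Or.inr ⟨rfl, rfl⟩
  | dollar => exact absurd (List.mem_map_of_mem hx) hq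

/-- After a bracket expression `z` and the dollar, a word of the language can only contain data
values from the part before `z`. -/
theorem mem_snd_of_mem_langU {D : Type*} {w z y : List (Letter × D)} {e : D}
    (hw : Letter.dollar ∉ letters w) (hz : IsBracketExpr (letters z))
    (h : w ++ z ++ (Letter.dollar, e) :: y ∈ langU D) {d : D} (hd : d ∈ y.map Prod.snd) :
    d ∈ w.map Prod.snd := by
  obtain ⟨q, m, s, e', heq, hqms, hm, hq, hqs⟩ := h
  have hqms' : Letter.dollar ∉ letters q ∧ Letter.dollar ∉ letters m ∧
      Letter.dollar ∉ letters s := by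
    simpa [letters, not_or, and_assoc] using hqms.1
  have hpair : ∀ {v : List (Letter × D)} {e : D}, Letter.dollar ∉ letters v →
      (Letter.dollar, e) ∉ v := fun hv h => hv (List.mem_map_of_mem (f := Prod.fst) h)
  have hsplit : w ++ z = q ++ m ∧ y = s := by
    rcases List.append_eq_append_iff.mp heq with ⟨t, h₁, h₂⟩ | ⟨t, h₁, h₂⟩
    · cases t with
      | nil => simp_all
      | cons x t =>
        have hx : x = (Letter.dollar, e) := (List.cons.inj h₂).1.symm
        have hmem : (Letter.dollar, e) ∈ q ++ m := by rw [h₁, ← hx]; simp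
        rcases List.mem_append.mp hmem with h | h
        · exact absurd h (hpair hqms'.1)
        · exact absurd h (hpair hqms'.2.1)
    · cases t with
      | nil => simp_all
      | cons x t =>
        have hx : x = (Letter.dollar, e') := (List.cons.inj h₂).1.symm
        have hmem : (Letter.dollar, e') ∈ w ++ z := by rw [h₁, ← hx]; simp
        rcases List.mem_append.mp hmem with h | h
        · exact absurd h (hpair hw)
        · exact absurd h (hpair hz.1)
  obtain ⟨hwz, rfl⟩ := hsplit
  have hdq : d ∈ q.map Prod.snd := by
    have : q.map Prod.snd = (y.map Prod.snd).reverse := by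
      rw [← List.map_reverse, ← List.forall₂_eq_eq_eq, List.forall₂_map_left_iff,
        List.forall₂_map_right_iff]
      exact hqs.imp fun _ _ h => h.1
    rw [this]
    exact List.mem_reverse.mpr hd
  -- `q` cannot end inside of `z`, because it ends with an unmatched bracket
  rcases List.append_eq_append_iff.mp hwz with ⟨t, rfl, rfl⟩ | ⟨t, rfl, rfl⟩
  · rcases List.eq_nil_or_concat t with rfl | ⟨t, x, rfl⟩
    · simpa using hdq
    · exfalso
      simp only [List.concat_eq_append] at hq hz
      have hx : x.1 = Letter.opening := by
        rcases hq with hq | ⟨q', e, hq⟩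
        · simp at hq
        · rw [← List.append_assoc] at hq
          rw [(List.append_inj' hq rfl).2 |> List.cons.inj |>.1]
      have h0 := hz.2.2
      have h1 := hz.2.1 (letters t) ⟨letters ([x] ++ m), by simp [letters]⟩
      rw [show letters (t ++ [x] ++ m) = letters t ++ ([x.1] ++ letters m) by simp [letters],
        bracketHeight_append, bracketHeight_append, hm.2.2, hx] at h0
      simp only [bracketHeight] at h0
      omega
  · rw [List.map_append]
    exact List.mem_append_left _ hdq

/-- There are words of any shape with distinct data values, and a further data value. -/
theorem exists_nodup_word {A D : Type*} [Infinite D] (u : List A) :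
    ∃ (w : List (A × D)) (d : D), letters w = u ∧ (w.map Prod.snd).Nodup ∧
      d ∉ w.map Prod.snd := by
  induction u with
  | nil => exact ⟨[], Classical.arbitrary D, rfl, List.nodup_nil, by simp⟩
  | cons x u ih =>
    obtain ⟨w, d, rfl, hw, hd⟩ := ih
    classical
    obtain ⟨d', hd'⟩ := Infinite.exists_notMem_finset (d :: w.map Prod.snd).toFinset
    exact ⟨(x, d) :: w, d', rfl, List.nodup_cons.mpr ⟨hd, hw⟩, fun h =>
      hd' (List.mem_toFinset.mpr h)⟩

/-! ### Values lost from the topmost stack -/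

namespace HOPAD

open PushdownSystem HStack

variable {n : ℕ} {Γ Q : Type*} {D : Type*} {M : HOPAD n Letter Γ Q}

/-- `N` is so large that for every `N` surroundings of a topmost stack, with values to be searched
for, two have the same types. -/
def ManyTypes (M : HOPAD n Letter Γ Q) (D : Type*) (N : ℕ) : Prop :=
  ∀ f : Fin N → TypeEnv n (Γ × Option D) D,
    (∀ i m, f i m ∈ stackTypes M.searchSystem M.searchFinal m) → ∃ i j, i < j ∧ f i = f j

theorem exists_manyTypes [Finite Q] (M : HOPAD n Letter Γ Q) (D : Type*) :
    ∃ N, 0 < N ∧ ManyTypes M D N := by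
  have hfin : {g : TypeEnv n (Γ × Option D) D |
      ∀ m, g m ∈ stackTypes M.searchSystem M.searchFinal m}.Finite :=
    Set.Finite.pi' fun m => finite_stackTypes _ _ m
  refine ⟨hfin.toFinset.card + 1, Nat.succ_pos _, fun f hf => ?_⟩
  obtain ⟨i, -, j, -, hij, h⟩ := Finset.exists_ne_map_eq_of_card_lt_of_maps_to
    (s := Finset.univ) (t := hfin.toFinset) (f := f) (by simp) fun i _ => by
      simpa using hf i
  rcases lt_or_gt_of_ne hij with h' | h'
  · exact ⟨i, j, h', h⟩
  · exact ⟨j, i, h', h.symm⟩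

/-- A value which has been lost from the topmost `K`-stack does not reappear in its descendants when
it is not read again. -/
theorem stores_of_cleanUp {K : ℕ} {C E : Zipper n (Γ × Option D) (Q × List (Letter × D))}
    (h : M.CleanUp K E C.state C.top C.below) (hnd : (E.state.2.map Prod.snd).Nodup) {d : D}
    (hd : d ∈ C.state.2.map Prod.snd) (hE : Stores d K E.top E.below) :
    Stores d K C.top C.below :=
  h.topHas (counts_wordSystem M d) hE (timesRead_le_of_nodup hnd hd)

/-- By determinism, a word of the language is accepted by a run through every configuration that is
reached after reading a proper prefix of it. -/
theorem Reachable.exists_accepting (hM : M.Recognizes (langU D))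
    {C : Zipper n (Γ × Option D) (Q × List (Letter × D))} (hC : M.Reachable C)
    {z : List (Letter × D)} (hne : z ≠ []) (hz : C.state.2 ++ z ∈ langU D) :
    ∃ G : Zipper n (Γ × Option D) (Q × List (Letter × D)), G.state.1 ∈ M.accepting ∧
      G.state.2 = C.state.2 ++ z ∧ Reach (M.wordSystem D) G C.state C.top C.below := by
  obtain ⟨G, hG, hGw, hr⟩ := accepts_iff.mp ((hM _).mpr hz)
  refine ⟨G, hG, hGw, reach_of_reach hC hr (hGw ▸ List.prefix_append _ _) fun h => hne ?_⟩
  rw [hGw] at h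
  simpa using h

/-- After reading a block `b_k` at the end of a word with distinct data values, some value from
this block is not stored in the topmost `k`-stack. -/
theorem exists_not_stores (hM : M.Recognizes (langU D)) {N : ℕ} (hpos : 0 < N)
    (hN : ManyTypes M D N) (k : ℕ) :
    ∀ {E : Zipper n (Γ × Option D) (Q × List (Letter × D))}, M.Reachable E →
      (E.state.2.map Prod.snd).Nodup → ∀ {w₁ w₂ : List (Letter × D)}, E.state.2 = w₁ ++ w₂ →
      Letter.dollar ∉ letters w₁ → NonnegHeights (letters w₁) → letters w₂ = blockWord N k →
      ∃ z ∈ w₂, ¬ Stores z.2 k E.top E.below := by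
  induction k with
  | zero =>
    intro E _ hnd w₁ w₂ hw _ _ hw₂
    obtain ⟨z₁, w₂, rfl, -, hw₂⟩ := List.map_eq_cons_iff.mp hw₂
    obtain ⟨z₂, w₂, rfl, -, -⟩ := List.map_eq_cons_iff.mp hw₂
    by_contra! h
    have h₁ := (h z₁ (by simp)).resolve_right fun ⟨m, hm, _⟩ => Nat.not_lt_zero _ hm
    have h₂ := (h z₂ (by simp)).resolve_right fun ⟨m, hm, _⟩ => Nat.not_lt_zero _ hm
    rw [hw, List.map_append] at hnd
    have := (List.nodup_append.mp hnd).2.1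
    simp only [List.map_cons, List.nodup_cons, List.mem_cons, not_or] at this
    exact this.1.1 (Option.some.inj (h₁.symm.trans h₂))
  | succ k ih =>
    intro E hE hnd w₁ w₂ hw hdol hheight hw₂
    by_contra! hall
    set b := blockWord N k with hb
    set L := b.length + 1 with hL
    have hbr : IsBracketExpr b := isBracketExpr_blockWord N k
    have hw₂' : letters w₂ = (List.replicate N (b ++ [Letter.opening])).flatten ++
      List.replicate N Letter.closing := hw₂
    have hlen : ∀ i, ((List.replicate i (b ++ [Letter.opening])).flatten).length = i * L := by
      intro i
      simp [hL]
    have hsplit : ∀ i j, i + j = N → letters w₂ =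
        (List.replicate i (b ++ [Letter.opening])).flatten ++
          ((List.replicate j (b ++ [Letter.opening])).flatten ++
            List.replicate N Letter.closing) := fun i j hij => by
      rw [hw₂', ← hij, List.replicate_add, List.flatten_append, List.append_assoc]
    have htake : ∀ i ≤ N, letters (w₂.take (i * L)) =
        (List.replicate i (b ++ [Letter.opening])).flatten := fun i hi => by
      rw [letters, List.map_take]
      change (letters w₂).take _ = _
      rw [hsplit i (N - i) (by omega)]
      exact List.take_left' (hlen i)
    have hdrop : ∀ i j, i + j = N → letters (w₂.drop (i * L)) =
        (List.replicate j (b ++ [Letter.opening])).flatten ++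
          List.replicate N Letter.closing := fun i j hij => by
      rw [letters, List.map_drop]
      change (letters w₂).drop _ = _
      rw [hsplit i j hij]
      exact List.drop_left' (hlen i)
    have hblock : ∀ i < N, letters ((w₂.drop (i * L)).take b.length) = b := fun i hi => by
      rw [letters, List.map_take]
      change (letters (w₂.drop (i * L))).take _ = _
      rw [hdrop i (N - 1 - i + 1) (by omega), List.replicate_succ, List.flatten_cons,
        List.append_assoc, List.append_assoc]
      exact List.take_left' rfl
    have hnest : ∀ i j, i + 1 + j = N →
        letters ((w₂.drop ((i + 1) * L)).take (j * (L + 1))) = nest b j := fun i j hij => by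
      rw [letters, List.map_take]
      change (letters (w₂.drop ((i + 1) * L))).take _ = _
      rw [hdrop (i + 1) j hij, ← hij, Nat.add_comm (i + 1) j, List.replicate_add,
        ← List.append_assoc]
      refine List.take_left' ?_
      rw [List.length_append, hlen, List.length_replicate]
      ring
    have hdol' : ∀ i ≤ N, Letter.dollar ∉ letters (w₁ ++ w₂.take (i * L)) := fun i hi h => by
      rw [letters, List.map_append, List.mem_append] at h
      rcases h with h | h
      · exact hdol h
      · exact (isBracketExpr_nest hbr i).1 (List.mem_append_left _ (htake i hi ▸ h))
    have hheight' : ∀ i ≤ N, NonnegHeights (letters (w₁ ++ w₂.take (i * L))) := fun i hi => by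
      rw [letters, List.map_append]
      refine hheight.append fun t ht => add_nonneg (hheight _ List.prefix_rfl)
        ((isBracketExpr_nest hbr i).2.1 t (ht.trans ?_))
      rw [show List.map Prod.fst (w₂.take (i * L)) = _ from htake i hi]
      exact List.prefix_append _ _
    have hmono : ∀ {i j : ℕ}, i ≤ j → w₁ ++ w₂.take i <+: w₁ ++ w₂.take j := fun h =>
      (List.prefix_append_right_inj w₁).mpr (List.take_prefix_take_left h)
    have hsubE : ∀ j, w₁ ++ w₂.take j <+: E.state.2 := fun j => by
      rw [hw]
      exact (List.prefix_append_right_inj w₁).mpr (List.take_prefix j w₂)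
    have hnodup : ∀ {C : Zipper n (Γ × Option D) (Q × List (Letter × D))},
        C.state.2 <+: E.state.2 → (C.state.2.map Prod.snd).Nodup := fun h =>
      hnd.sublist (h.map Prod.snd).sublist
    -- the ancestor of the topmost `k`-stack before `w₂`
    obtain ⟨z₀, u₀, hz₀⟩ : ∃ z u, w₂ = z :: u := by
      refine List.exists_cons_of_ne_nil fun h => ?_
      rw [h] at hw₂'
      have := congrArg List.length hw₂'
      simp [letters] at this
      omega
    obtain ⟨C₀, hC₀, hC₀w, hup₀⟩ := hE.exists_up hnd (v := w₁) (u := u₀) (z := z₀) (K := k)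
      (by rw [hw, hz₀]) (hall z₀ (by rw [hz₀]; exact List.mem_cons_self))
    have hclean₀ : M.CleanUp k E C₀.state C₀.top C₀.below :=
      hC₀.cleanUp hnd hup₀ fun v hv z hz => hall z (by
        rw [hC₀w, hw] at hv
        rwa [List.append_cancel_left hv])
    -- every further block loses a value, by the induction hypothesis, and what is lost stays lost
    have hstep : ∀ i < N, ∀ A : Zipper n (Γ × Option D) (Q × List (Letter × D)),
        M.Reachable A → M.CleanUp k E A.state A.top A.below →
        A.state.2 <+: w₁ ++ w₂.take (i * L + b.length) →
        ∃ C : Zipper n (Γ × Option D) (Q × List (Letter × D)), M.Reachable C ∧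
          M.CleanUp k E C.state C.top C.below ∧
          C.state.2 = w₁ ++ w₂.take (i * L + b.length) ∧
          M.CleanUp k C A.state A.top A.below ∧
          ∃ z ∈ (w₂.drop (i * L)).take b.length, ¬ Stores z.2 k C.top C.below := by
      intro i hi A hA hAE hAw
      obtain ⟨C, hCw, hAC, hCE⟩ := hAE.split hAw (hsubE _)
      have hC := hA.trans hAC.reach
      refine ⟨C, hC, hCE, hCw, hAC, ?_⟩
      exact ih hC (hnodup (hCw ▸ hsubE _)) (w₁ := w₁ ++ w₂.take (i * L))
        (by rw [hCw, List.take_add, List.append_assoc]) (hdol' i hi.le) (hheight' i hi.le)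
        (hblock i hi)
    have hblocks : ∀ i < N, ∃ C : Zipper n (Γ × Option D) (Q × List (Letter × D)),
        M.Reachable C ∧ M.CleanUp k E C.state C.top C.below ∧
        C.state.2 = w₁ ++ w₂.take (i * L + b.length) ∧
        ∀ i' ≤ i, ∃ z ∈ (w₂.drop (i' * L)).take b.length, ¬ Stores z.2 k C.top C.below := by
      intro i
      induction i with
      | zero =>
        intro hi
        obtain ⟨C, hC, hCE, hCw, -, h⟩ := hstep 0 hi C₀ hC₀ hclean₀
          (hC₀w ▸ List.prefix_append _ _)
        exact ⟨C, hC, hCE, hCw, fun i' hi' => by rwa [Nat.le_zero.mp hi']⟩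
      | succ i ihi =>
        intro hi
        obtain ⟨A, hA, hAE, hAw, hold⟩ := ihi (by omega)
        obtain ⟨C, hC, hCE, hCw, hAC, h⟩ := hstep (i + 1) hi A hA hAE (hAw ▸ hmono (by
          rw [Nat.succ_mul]; omega))
        refine ⟨C, hC, hCE, hCw, fun i' hi' => ?_⟩
        rcases Nat.le_succ_iff.mp hi' with hi' | rfl
        · obtain ⟨z, hz, hzA⟩ := hold i' hi'
          refine ⟨z, hz, fun hzC => hzA ?_⟩
          refine stores_of_cleanUp hAC (hnodup (hCw ▸ hsubE _)) ?_ hzC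
          rw [hAw, List.map_append]
          refine List.mem_append_right _ (List.mem_map_of_mem ?_)
          rw [List.take_drop] at hz
          exact (List.take_prefix_take_left (by gcongr)).subset (List.mem_of_mem_drop hz)
        · exact h
    -- `C` is reached after the last block, when each block has lost a value
    obtain ⟨C, hC, hCE, hCw, hlost⟩ := hblocks (N - 1) (by omega)
    have hlost' : ∀ i : Fin N, ∃ z ∈ (w₂.drop (i * L)).take b.length,
        ¬ Stores z.2 k C.top C.below := fun i => hlost i (by omega)
    choose d hdmem hdlost using hlost'
    obtain ⟨i, j, hij, htypes⟩ := hN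
      (fun i m => stackType M.searchSystem M.searchFinal (d i).2 m (C.below m))
      fun i m => stackType_mem _ _ _ m _
    -- after block `i`, read the blocks until the height is the same again
    obtain ⟨r, hr⟩ : ∃ r, i.val + 1 + r = N := ⟨N - 1 - i, by omega⟩
    set W := w₁ ++ w₂.take ((i + 1) * L) with hW
    set z := (w₂.drop ((i + 1) * L)).take (r * (L + 1)) with hz
    have hWz : W ++ z = w₁ ++ w₂.take ((i + 1) * L + r * (L + 1)) := by
      rw [hW, hz, List.append_assoc, ← List.take_add]
    have hle : (N - 1) * L + b.length ≤ (i + 1) * L + r * (L + 1) := by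
      have h1 : (N - 1) * L + L = N * L := by
        rw [← Nat.succ_mul]
        congr 1
        omega
      have h2 : (i + 1) * L + r * (L + 1) = (i + 1 + r) * L + r := by ring
      rw [hr] at h2
      omega
    obtain ⟨C', hC'w, hCC', -⟩ := hCE.split (v := W ++ z) (by rw [hWz, hCw]; exact hmono hle)
      (hWz ▸ hsubE _)
    have hlast : ∃ q' e, W = q' ++ [(Letter.opening, e)] := by
      have h : letters W = letters w₁ ++ (List.replicate i (b ++ [Letter.opening])).flatten ++ b ++
          [Letter.opening] := by
        rw [hW, letters, List.map_append]
        change _ ++ letters _ = _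
        rw [htake _ (by omega), List.replicate_succ', List.flatten_append]
        simp [letters]
      obtain ⟨q', t, hq', -, ht⟩ := List.map_eq_append_iff.mp h
      obtain ⟨⟨x, e⟩, t, rfl, hx, ht⟩ := List.map_eq_cons_iff.mp ht
      obtain rfl := List.map_eq_nil_iff.mp ht
      obtain rfl : x = Letter.opening := hx
      exact ⟨q', e, hq'⟩
    have hdW := hdol' (i + 1) (by omega)
    have hbrz : IsBracketExpr (letters z) := hnest i r hr ▸ isBracketExpr_nest hbr r
    have hblk : ∀ i : Fin N, d i ∈ w₂.take (i * L + b.length) ∧ d i ∈ w₂.drop (i * L) := fun i => by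
      have h := hdmem i
      refine ⟨?_, List.mem_of_mem_take h⟩
      rw [List.take_drop] at h
      exact List.mem_of_mem_drop h
    have hiW : (d i).2 ∈ W.map Prod.snd := by
      rw [hW, List.map_append]
      refine List.mem_append_right _ (List.mem_map_of_mem ?_)
      refine (List.take_prefix_take_left ?_).subset (hblk i).1
      rw [Nat.succ_mul]
      omega
    have hjW : (d j).2 ∉ W.map Prod.snd := fun h => by
      have hsplitE : E.state.2 = W ++ w₂.drop ((i + 1) * L) := by
        rw [hw, hW, List.append_assoc, List.take_append_drop]
      rw [hsplitE, List.map_append] at hnd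
      refine (List.nodup_append.mp hnd).2.2 _ h _ (List.mem_map_of_mem ?_) rfl
      have hsub : (i.val + 1) * L ≤ j * L := Nat.mul_le_mul_right L hij
      exact (List.drop_sublist_drop_left w₂ hsub).subset (hblk j).2
    have hCd : ∀ i : Fin N, (d i).2 ∈ C.state.2.map Prod.snd := fun i => by
      rw [hCw, List.map_append]
      refine List.mem_append_right _ (List.mem_map_of_mem ?_)
      refine (List.take_prefix_take_left ?_).subset (hblk i).1
      gcongr
      omega
    -- after the dollar, the mirror image of `W` contains the lost value `d i`; by the equality of
    -- the types, some word containing `d j` is accepted as well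
    obtain ⟨G, hG, hGw, hGr⟩ := (hC.trans hCC'.reach).exists_accepting hM
      (z := (Letter.dollar, z₀.2) :: mirror W) (List.cons_ne_nil _ _) (by
        rw [hC'w]
        exact mem_langU _ hdW (hheight' (i + 1) (by omega)) hbrz (Or.inr hlast))
    obtain ⟨v, hv⟩ := hCC'.reach.prefix
    obtain ⟨G', hG', ⟨y, hy, e, y', rfl, hdy⟩, hGr'⟩ := CleanUp.transfer (d := (d i).2)
      (d' := (d j).2) (a' := C.below) hGr hG hGw ⟨_, _, rfl, mem_snd_mirror.mpr hiW⟩ hCC' hv.symm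
      (fun y hy => by
        have h : (C'.state.2.map Prod.snd).Nodup := hnodup (by rw [hC'w, hWz]; exact hsubE _)
        rw [← hv, List.map_append] at h
        have h := (List.nodup_append.mp h).2.2
        exact ⟨fun hyd => h _ (hCd i) _ (List.mem_map_of_mem hy) hyd.symm,
          fun hyd => h _ (hCd j) _ (List.mem_map_of_mem hy) hyd.symm⟩)
      (fun h => (h.or fun _ => eq_of_exchange_ne).elim (hdlost i) (hdlost j))
      (fun _ _ => rfl) (fun m _ => by
        rw [show stackType M.searchSystem M.searchFinal (d i).2 m (C.below m) = _ from
          congrFun htypes m]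
        exact mem_stackType _ _ _)
    have hU := (hM _).mp (accepts_iff.mpr ⟨G', hG', hy, hC.trans hGr'⟩)
    rw [hC'w] at hU
    exact hjW (mem_snd_of_mem_langU hdW hbrz hU hdy)

theorem not_recognizes_langU [Infinite D] [Finite Q] (M : HOPAD n Letter Γ Q) :
    ¬ M.Recognizes (langU D) := by
  intro hM
  obtain ⟨N, hpos, hN⟩ := exists_manyTypes M D
  have hbr := isBracketExpr_blockWord N n
  obtain ⟨w', d', hw', hnd, hd'⟩ := exists_nodup_word (D := D) (blockWord N n ++ [Letter.opening])
  obtain ⟨w, t, rfl, hw, ht⟩ := List.map_eq_append_iff.mp hw'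
  obtain ⟨⟨x, e⟩, t, rfl, hx, ht⟩ := List.map_eq_cons_iff.mp ht
  obtain rfl := List.map_eq_nil_iff.mp ht
  obtain rfl : x = Letter.opening := hx
  set W := w ++ [(Letter.opening, e)] with hW
  have hdW : Letter.dollar ∉ letters W := by
    rw [hw']
    simpa using hbr.1
  have hhW : NonnegHeights (letters W) := by
    rw [hw']
    refine NonnegHeights.append hbr.2.1 fun t ht => ?_
    rw [hbr.2.2, zero_add]
    rcases List.prefix_concat_iff.mp (show t <+: [] ++ [Letter.opening] from ht) with rfl | ht
    · simp [bracketHeight]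
    · rw [List.prefix_nil.mp ht, bracketHeight]
  have hnil : IsBracketExpr (letters ([] : List (Letter × D))) :=
    ⟨by simp [letters], fun v hv => by rw [List.prefix_nil.mp hv, bracketHeight], rfl⟩
  -- the run on `W $ s`, where `s` is the mirror image of `W`, passes through `E` after `w`, and
  -- through `C` after `W`
  have hlang := mem_langU e hdW hhW hnil (Or.inr ⟨w, e, rfl⟩)
  rw [List.append_nil] at hlang
  obtain ⟨G, hG, hGw, hGr⟩ := accepts_iff.mp ((hM _).mpr hlang)
  have hup : M.CleanUp n G _ _ _ := Reach.up hGr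
  obtain ⟨E, hE, hEr, hGE⟩ := hup.split (v := w) List.nil_prefix (by
    rw [hGw, hW, List.append_assoc]
    exact List.prefix_append _ _)
  obtain ⟨C, hC, hCE, hGC⟩ := hGE.split (v := W) (hE ▸ List.prefix_append _ _) (by
    rw [hGw]
    exact List.prefix_append _ _)
  have hnd' : (w.map Prod.snd).Nodup :=
    hnd.sublist ((List.prefix_append w [(Letter.opening, e)]).map Prod.snd).sublist
  obtain ⟨z, hz, hzE⟩ := exists_not_stores hM hpos hN n (w₁ := []) (w₂ := w) hEr.reach
    (by rw [hE]; exact hnd') (by rw [hE, List.nil_append]) (by simp [letters]) hnil.2.1 hw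
  have hCr : M.Reachable C := Reachable.trans hEr.reach hCE.reach
  have hzC : ¬ Stores z.2 n C.top C.below := fun h =>
    hzE (stores_of_cleanUp hCE (by rwa [hC]) (hE ▸ List.mem_map_of_mem hz) h)
  have hdC : ¬ Stores d' n C.top C.below := fun h => hd' (by
    have := hCr.mem_of_stores h
    rwa [hC] at this)
  -- the whole stack of `C` stores neither the lost value `z.2` nor the unused value `d'`
  obtain ⟨G', hG', ⟨y, hy, e', y', rfl, hdy⟩, hGr'⟩ := CleanUp.transfer (d := z.2) (d' := d')
    (K := n) (C := C) (a' := C.below) hGC.reach hG (z := (Letter.dollar, e) :: mirror W)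
    (by rw [hGw, hC]) ⟨_, _, rfl, mem_snd_mirror.mpr (List.mem_map_of_mem
      (List.mem_append_left _ hz))⟩ .refl (v := []) (List.append_nil _).symm (by simp)
    (fun h => (h.or fun _ => eq_of_exchange_ne).elim hzC hdC) (fun _ _ => rfl)
    fun m hm => absurd m.isLt (not_lt.mpr hm)
  have hU := (hM _).mp (accepts_iff.mpr ⟨G', hG', hy, hCr.trans hGr'⟩)
  rw [hC, ← List.append_nil W] at hU
  exact hd' (mem_snd_of_mem_langU hdW hnil hU hdy)

end HOPAD

theorem mainTheorem5 {D : Type*} [Infinite D] {Γ Q : Type*} [Finite Γ] [Finite Q] (n : ℕ)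
    (M : HOPAD n Letter Γ Q) :
    (M.Recognizes (langU D) →
      ∀ w : List (Letter × D), letters w = wordW (bigN n Q) n → (w.map Prod.snd).Nodup →
        ∃ R : HOPAD.Steps n Letter Γ Q D,
          -- `R` is the unique run which reads `w` and ends just after its last letter
          M.IsExactRun w R ∧ (∀ R' : HOPAD.Steps n Letter Γ Q D, M.IsExactRun w R' → R' = R) ∧
          -- some value read while passing from `u` to `u w_k` is lost from the topmost `k`-stack
          (∀ k : ℕ, k ≤ n → ∀ u : List Letter,
            u ++ wordW (bigN n Q) k <+: wordW (bigN n Q) n →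
            ∃ d : D,
              HOPAD.ReadsValue
                (HOPAD.Steps.segment u.length (u ++ wordW (bigN n Q) k).length R) d ∧
              ∃ t : HStack Γ D k,
                HStack.IsTop k t n
                  (HOPAD.Steps.last (M.init D)
                    (HOPAD.Steps.upTo (u ++ wordW (bigN n Q) k).length R)).stack ∧
                d ∉ HStack.dataValues k t) ∧
          -- every value read so far appears in the current stack
          (∀ v : List Letter, v <+: wordW (bigN n Q) n → ∀ d : D,
            HOPAD.ReadsValue (HOPAD.Steps.upTo v.length R) d →
            d ∈ HStack.dataValues n
              (HOPAD.Steps.last (M.init D) (HOPAD.Steps.upTo v.length R)).stack)) ∧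
    -- the case `k = n` of the former contradicts the latter
    ¬ M.Recognizes (langU D) := by
  have h : ¬ M.Recognizes (langU D) := HOPAD.not_recognizes_langU M
  -- the first claim presupposes that `U` is recognized, which the second one excludes
  exact ⟨fun hr => absurd hr h, h⟩
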